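/- **Setting.** Let $\mathcal X,\mathcal M,\mathcal M',\hat{\mathcal X}$ be finite non-empty sets, $T(x'|x)$ an irreducible aperiodic transition kernel on $\mathcal X$ with invariant distribution $\zeta$, $O(m'|m)$ a (channel) kernel from $\mathcal M$ to $\mathcal M'$, $d:\mathcal X\times\hat{\mathcal X}\to[0,\infty)$ a distortion function, $\|d\|_\infty=\max d$, $\beta\in(0,1)$, and $N\ge 0$ an integer. Let $\mathcal Q$ be the set of all quantizers $Q:\mathcal X\to\mathcal M$. For $\pi\in\mathcal P(\mathcal X)$, $Q\in\mathcal Q$, $m'\in\mathcal M'$, put $P(m'|\pi,Q)=\sum_x O(m'|Q(x))\pi(x)$ and $$c(\pi,Q)=\sum_{m'}\min_{\hat x}\sum_x d(x,\hat x)\,O(m'|Q(x))\,\pi(x),\qquad F(\pi,m',Q)(x')=\sum_x T(x'|x)\frac{O(m'|Q(x))\pi(x)}{P(m'|\pi,Q)}$$ (when $P(m'|\pi,Q)=0$, the fraction is replaced by $\pi(x)$). **Window MDP.** A window is $I=(m'_{-N},\dots,m'_{-1},Q_{-N},\dots,Q_{-1})\in\mathcal I=(\mathcal M')^N\times\mathcal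 Q^N$, and $\mathcal W=\mathcal P(\mathcal X)\times\mathcal I$. For $w=(\pi,I)\in\mathcal W$ let $\varphi(w)$ be the result of applying $F$ successively, starting from $\pi$, with $(m'_{-N},Q_{-N}),\dots,(m'_{-1},Q_{-1})$. From $w$ under the action $Q$, an output $m'$ is drawn from $P(\cdot\,|\varphi(w),Q)$, the pair $(m',Q)$ is appended to the window, the oldest pair is removed from it, and $\pi$ is updated by $F$ with the removed pair; the cost is $c(\varphi(w),Q)$. For $\gamma:\mathcal W\to\mathcal Q$ let $J_\beta(w,\gamma)=\mathbf E^\gamma_w\big[\sum_{t\ge0}\beta^t c(\varphi(W_t),\gamma(W_t))\big]$, and $J^*_\beta(w)=\inf_\gamma J_\beta(w,\gamma)$. **Q-learning under uniform exploration.** Let $X_t$ be the Markov chain with kernel $T$ and an arbitrary initial law $\pi_0$; let $Q_t$ be uniform on $\mathcal Q$, independent of $X$ and of the past, and let $M'_t\sim O(\cdot|Q_t(X_t))$ ($t\ge 0$). With $I_t=(M'_{[t,t+N-1]},Q_{[t,t+N-1]})$, $U_t=Q_{t+N}$ and $C_t=c(\varphi(\zeta,I_t),U_t)$, let $V_0:\mathcal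 I\times\mathcal Q\to\mathbb R$ be arbitrary and $$V_{t+1}(I_t,U_t)=(1-\alpha_t)V_t(I_t,U_t)+\alpha_t\Big[C_t+\beta\min_{v\in\mathcal Q}V_t(I_{t+1},v)\Big],\qquad \alpha_t=\frac{1}{1+\sum_{k=0}^t\mathbf 1\{(I_k,U_k)=(I_t,U_t)\}},$$ with $V_{t+1}(I,Q)=V_t(I,Q)$ for $(I,Q)\ne(I_t,U_t)$. **Theorem.** There is a (deterministic) function $V^*:\mathcal I\times\mathcal Q\to\mathbb R$ such that, almost surely, $V_t(I,Q)\to V^*(I,Q)$ for all $(I,Q)$. Moreover, let $\hat\gamma^*_N(I)\in\arg\min_{Q}V^*(I,Q)$ for every $I$ (any choice of minimizers), and $\tilde\gamma^*_N(\pi,I)=\hat\gamma^*_N(I)$. For a kernel $K$ between finite sets let $\delta(K)=\inf\sum_i\min(K(B_i|a),K(B_i|b))$, where the infimum is over all points $a,b$ and all partitions $\{B_i\}$ of the target. If $\alpha:=(1-\delta(T))(2-\delta(O))<1$, then $$\mathbf E^{\gamma}_{\pi_{-N}}\big[J_\beta(W_0,\tilde\gamma^*_N)-J^*_\beta(W_0)\big]\le\frac{4\|d\|_\infty}{(1-\beta)^2}\,\alpha^N$$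 for every prior $\pi_{-N}\in\mathcal P(\mathcal X)$ and every policy $\gamma$ that at each of the times $-N,\dots,-1$ chooses the quantizer as a function of the past channel outputs and past quantizers since time $-N$ (in particular as a function of the current predictor). Here $W_0=(\pi_{-N},I_0)$, where $I_0$ is the window of channel outputs and quantizers generated at times $-N,\dots,-1$ by $\gamma$, with $X_{-N}\sim\pi_{-N}$. -/

import Mathlib

open Filter Topology MeasureTheory

namespace ZeroDelay

noncomputable section

/-- Quantizers: maps from the source alphabet `X` to the channel input alphabet `M`. -/
abbrev Quantizer (X M : Type*) := X → M

/-- Probability measures on a finite set, as probability vectors. -/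
abbrev Belief (X : Type*) [Fintype X] := stdSimplex ℝ X

/-- A window of `N` past channel outputs and `N` past quantizers, the oldest ones first. -/
abbrev Window (X M Y : Type*) (N : ℕ) := (Fin N → Y) × (Fin N → Quantizer X M)

/-- The state space of the sliding finite window belief MDP: the predictor from `N` time steps
ago, together with the window `I`. -/
abbrev WindowState (X M Y : Type*) [Fintype X] (N : ℕ) := Belief X × Window X M Y N

/-- Every state of the chain with transition probabilities `T x x'` has period one. -/
def IsAperiodic {X : Type*} [Fintype X] [DecidableEq X] (T : X → Belief X) : Prop :=
  ∀ (x : X) (k : ℕ),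
    (∀ n : ℕ, 0 < n → 0 < ((Matrix.of fun a b => T a b) ^ n) x x → k ∣ n) → k = 1

/-- The Dobrushin coefficient of a kernel between finite sets: the infimum of
`∑ i, min (K (B i | x)) (K (B i | y))` over all points `x, y` and all partitions `B` of the
target. -/
def dobrushin {A B : Type*} [Fintype B] [DecidableEq B] (K : A → Belief B) : ℝ :=
  ⨅ p : (A × A) × Finpartition (Finset.univ : Finset B),
    ∑ S ∈ p.2.parts, min (∑ b ∈ S, K p.1.1 b) (∑ b ∈ S, K p.1.2 b)

section Model

variable {X M Y Xh : Type*} [Fintype X] [Fintype Y]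

/-- The probability of the channel output `y` when the source symbol has law `p` and the
quantizer `q` is used: `∑ x, O (y | q x) p x`. -/
def outputProb (O : M → Belief Y) (p : Belief X) (q : Quantizer X M) (y : Y) : ℝ :=
  ∑ x, O (q x) y * p x

lemma outputProb_nonneg (O : M → Belief Y) (p : Belief X) (q : Quantizer X M) (y : Y) :
    0 ≤ outputProb O p q y :=
  Finset.sum_nonneg fun x _ => mul_nonneg ((O (q x)).2.1 y) (p.2.1 x)

open Classical in
/-- The Bayes update of the predictor `p` to the filter, after the channel output `y` under the
quantizer `q`. The formula makes no sense when the output `y` has probability zero; then the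
filter is set to `p`. -/
def bayes (O : M → Belief Y) (p : Belief X) (y : Y) (q : Quantizer X M) : Belief X :=
  if h : outputProb O p q y = 0 then p
  else ⟨fun x => O (q x) y * p x / outputProb O p q y,
    fun x => div_nonneg (mul_nonneg ((O (q x)).2.1 y) (p.2.1 x)) (outputProb_nonneg O p q y),
    by rw [← Finset.sum_div]; exact div_self h⟩

/-- The action of the source kernel on probability measures. -/
def push (T : X → Belief X) (p : Belief X) : Belief X :=
  ⟨fun x' => ∑ x, T x x' * p x,
    fun x' => Finset.sum_nonneg fun x _ => mul_nonneg ((T x).2.1 x') (p.2.1 x), by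
      rw [Finset.sum_comm]
      simp_rw [← Finset.sum_mul]
      have h : ∀ x, ∑ x', T x x' = 1 := fun x => (T x).2.2
      simp_rw [h, one_mul]
      exact p.2.2⟩

/-- One step of the predictor recursion. -/
def update (T : X → Belief X) (O : M → Belief Y) (p : Belief X) (y : Y) (q : Quantizer X M) :
    Belief X :=
  push T (bayes O p y q)

/-- The map `φ` from window states to the current predictor: `N` steps of the recursion. -/
def predictor {N : ℕ} (T : X → Belief X) (O : M → Belief Y) (w : WindowState X M Y N) :
    Belief X :=
  Fin.foldl N (fun p i => update T O p (w.2.1 i) (w.2.2 i)) w.1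

/-- The window after the new output `y` and the new quantizer `q`: the oldest pair is dropped. -/
def shiftWindow {N : ℕ} (I : Window X M Y N) (y : Y) (q : Quantizer X M) : Window X M Y N :=
  (Fin.tail (Fin.snoc I.1 y : Fin (N + 1) → Y),
    Fin.tail (Fin.snoc I.2 q : Fin (N + 1) → Quantizer X M))

/-- The next window state: the belief coordinate is updated with the oldest pair, the one that
leaves the window. -/
def nextState {N : ℕ} (T : X → Belief X) (O : M → Belief Y) (w : WindowState X M Y N)
    (y : Y) (q : Quantizer X M) : WindowState X M Y N :=
  (update T O w.1 ((Fin.snoc w.2.1 y : Fin (N + 1) → Y) 0)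
      ((Fin.snoc w.2.2 q : Fin (N + 1) → Quantizer X M) 0),
    shiftWindow w.2 y q)

/-- The one stage cost `∑ y, min_x̂ ∑ x, d (x, x̂) O (y | q x) p x` at the predictor `p`. -/
def stageCost [Fintype Xh] [Nonempty Xh] (O : M → Belief Y) (d : X → Xh → ℝ)
    (p : Belief X) (q : Quantizer X M) : ℝ :=
  ∑ y, Finset.univ.inf' Finset.univ_nonempty fun xh : Xh => ∑ x, d x xh * O (q x) y * p x

/-- `max d (x, x̂)`. -/
def distNorm [Nonempty X] [Fintype Xh] [Nonempty Xh] (d : X → Xh → ℝ) : ℝ :=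
  Finset.univ.sup' Finset.univ_nonempty fun p : X × Xh => d p.1 p.2

/-- The transition operator of the sliding finite window belief MDP under the stationary policy
`g`: `(stepExp f) w` is the expectation of `f (W (t+1))` given `W t = w`. -/
def stepExp {N : ℕ} (T : X → Belief X) (O : M → Belief Y)
    (g : WindowState X M Y N → Quantizer X M) (f : WindowState X M Y N → ℝ)
    (w : WindowState X M Y N) : ℝ :=
  ∑ y, outputProb O (predictor T O w) (g w) y * f (nextState T O w y (g w))

/-- The discounted cost `J_β (w, g) = E [∑ t, β ^ t c (W t, g (W t))]` from `W 0 = w`. -/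
def discountedCost [Fintype Xh] [Nonempty Xh] {N : ℕ} (T : X → Belief X) (O : M → Belief Y)
    (d : X → Xh → ℝ) (β : ℝ) (w : WindowState X M Y N)
    (g : WindowState X M Y N → Quantizer X M) : ℝ :=
  ∑' t : ℕ, β ^ t * ((stepExp T O g)^[t] fun v => stageCost O d (predictor T O v) (g v)) w

/-- The optimal discounted cost `J*_β (w)` over stationary window belief policies. -/
def optimalCost [Fintype Xh] [Nonempty Xh] {N : ℕ} (T : X → Belief X) (O : M → Belief Y)
    (d : X → Xh → ℝ) (β : ℝ) (w : WindowState X M Y N) : ℝ :=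
  ⨅ g : WindowState X M Y N → Quantizer X M, discountedCost T O d β w g

/-- The policies that act on the first `N` time steps (times `-N, …, -1`): each
quantizer is a function of the past channel outputs and the past quantizers. Since the prior is
given, this includes every policy that selects the quantizer as a function of the predictor. -/
abbrev InitialPolicy (X M Y : Type*) (N : ℕ) :=
  (i : Fin N) → (Fin i → Y) → (Fin i → Quantizer X M) → Quantizer X M

open Classical in
/-- The probability of the initial window `I` when the source starts with law `μ` at time `-N`
and the policy `g` acts on times `-N, …, -1`; the sum is over the source paths at the times
`-N, …, 0`. -/
def initialProb {N : ℕ} (T : X → Belief X) (O : M → Belief Y) (μ : Belief X)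
    (g : InitialPolicy X M Y N) (I : Window X M Y N) : ℝ :=
  if ∀ i : Fin N, I.2 i = g i (fun j => I.1 (Fin.castLE i.isLt.le j))
      (fun j => I.2 (Fin.castLE i.isLt.le j))
  then ∑ x : Fin (N + 1) → X,
    μ (x 0) * ∏ i : Fin N, O (I.2 i (x i.castSucc)) (I.1 i) * T (x i.castSucc) (x i.succ)
  else 0

/-- The expectation of `F (W 0)`, where `W 0 = (μ, I)` and `I` is generated by `g` from the
prior `μ` at time `-N`. -/
def initialExp [DecidableEq X] [Fintype M] {N : ℕ} (T : X → Belief X) (O : M → Belief Y)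
    (μ : Belief X) (g : InitialPolicy X M Y N) (F : WindowState X M Y N → ℝ) : ℝ :=
  ∑ I : Window X M Y N, initialProb T O μ g I * F (μ, I)

/-- The processes of source symbols, quantizers and channel outputs generated by uniform
exploration: the source is a Markov chain with initial law `p0` and kernel `T`, each quantizer
is uniform and independent of the past and of the source, and the output is drawn from
`O (· | q x)`. -/
structure IsExploration [DecidableEq X] [Fintype M] {Ω : Type*} [MeasurableSpace Ω]
    (ℙ : Measure Ω) (T : X → Belief X) (O : M → Belief Y) (p0 : Belief X)
    (src : ℕ → Ω → X) (qnt : ℕ → Ω → Quantizer X M) (out : ℕ → Ω → Y) : Prop where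
  measurable_src : ∀ t x, MeasurableSet {ω | src t ω = x}
  measurable_qnt : ∀ t q, MeasurableSet {ω | qnt t ω = q}
  measurable_out : ∀ t y, MeasurableSet {ω | out t ω = y}
  law : ∀ (n : ℕ) (x : ℕ → X) (q : ℕ → Quantizer X M) (y : ℕ → Y),
    ℙ.real {ω | ∀ i ≤ n, src i ω = x i ∧ qnt i ω = q i ∧ out i ω = y i} =
      p0 (x 0) * (∏ i ∈ Finset.range n, T (x i) (x (i + 1))) *
        ∏ i ∈ Finset.range (n + 1),
          (1 / (Fintype.card (Quantizer X M) : ℝ) * O (q i (x i)) (y i))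

/-- The window seen at time `t`, after a shift of the time index by `N`: the data with sample
indices `t, …, t + N - 1`. -/
def dataWindow {N : ℕ} (qs : ℕ → Quantizer X M) (ys : ℕ → Y) (t : ℕ) : Window X M Y N :=
  (fun i => ys (t + i), fun i => qs (t + i))

/-- The Q-learning iterates `V t` along a state sequence `z`, an action sequence `u` and a cost
sequence `c`, with the step size `1 / (1 + number of visits to (z, u) up to time t)`. -/
def qIterate {Z U : Type*} [DecidableEq Z] [DecidableEq U] [Fintype U] [Nonempty U] (β : ℝ)
    (V0 : Z → U → ℝ) (z : ℕ → Z) (u : ℕ → U) (c : ℕ → ℝ) : ℕ → Z → U → ℝ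
  | 0 => V0
  | t + 1 => fun s a =>
      let V := qIterate β V0 z u c t
      let α : ℝ := 1 / (1 + ∑ k ∈ Finset.range (t + 1), if z k = s ∧ u k = a then 1 else 0)
      if s = z t ∧ a = u t then
        (1 - α) * V s a
          + α * (c t + β * Finset.univ.inf' Finset.univ_nonempty fun v => V (z (t + 1)) v)
      else V s a

/-- Q-learning for the sliding finite window scheme. The state at time `t` is `(ζ, I t)` with
`I t` the data window; as its first coordinate is fixed, it is identified with `I t`. The action
is the quantizer with sample index `t + N`, and the cost is `c (φ (ζ, I t), action)`. -/
def windowQ [DecidableEq X] [Fintype M] [Nonempty M] [DecidableEq M] [DecidableEq Y]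
    [Fintype Xh] [Nonempty Xh] (N : ℕ) (T : X → Belief X) (O : M → Belief Y) (d : X → Xh → ℝ)
    (β : ℝ) (ζ : Belief X) (V0 : Window X M Y N → Quantizer X M → ℝ)
    (qs : ℕ → Quantizer X M) (ys : ℕ → Y) : ℕ → Window X M Y N → Quantizer X M → ℝ :=
  qIterate β V0 (fun t => dataWindow qs ys t) (fun t => qs (t + N))
    (fun t => stageCost O d (predictor T O (ζ, dataWindow (N := N) qs ys t)) (qs (t + N)))

end Model

end

end ZeroDelay

/-! Freezing the belief at the start of every window at `ζ` turns the window model into a finite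
Markov decision process, whose optimality equation has a bounded solution `V`
(`exists_isWindowValue`). Two things are needed: `V` is nearly exact for the true model, and
Q-learning finds `V` wherever it matters.

Accuracy. Write `a` for `(1 - dobrushin T) * (2 - dobrushin O)`. One step of the predictor recursion
contracts the expected `ℓ¹` distance of two predictors by the factor `a`
(`sum_outputProb_mul_l1dist_update_le`): Bayes' rule expands by at most `2 - dobrushin O`, the
source kernel contracts by `1 - dobrushin T`. In the true model `V` misses the Bellman equation by
at most `distNorm d / (1 - β)` times the distance between the true predictor and the one restarted
from `ζ` (`abs_bellman_sub_windowValue_le`). The potential `stabilityPotential` dominates the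
expected discounted sum of these distances under every policy (`stabilityPotential_step`), so both
the optimal cost and the cost of the greedy policy are compared with the minimum of `V`, at the
price of one potential each. The expected potential of the initial state is at most `2 / (1 - β) * a
^ N`, which gives the constant 4.

Learning. With the step size used, each iterate is an exact average of its samples, so convergence
is a deterministic consequence of the convergence of empirical averages (`tendsto_qIterate`). These
averages come from the Poisson equation of the source and a strong law for bounded orthogonal
variables (`ae_tendsto_average_window`).

The link. Windows of zero stationary mass are never visited and keep the value `V0`, so the learned
policy is greedy for `V` only at the other windows. This suffices: `ζ` is strictly positive, hence
every prior is dominated by a multiple of `ζ`, and `IsDominated` is propagated along all transitions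
of positive probability, so only windows of positive mass are ever reached. -/

namespace ZeroDelay

noncomputable section

/-! ### Dobrushin coefficients and contraction of the predictor recursion -/

section Contraction

variable {X M Y A B : Type*} [Fintype X] [Fintype Y]

/-- The `ℓ¹` distance of two probability vectors. -/
def l1dist (p p' : Belief X) : ℝ := ∑ x, |p x - p' x|

lemma belief_nonneg (p : Belief X) (x : X) : 0 ≤ p x := p.2.1 x

lemma belief_sum (p : Belief X) : ∑ x, p x = 1 := p.2.2

lemma belief_le_one (p : Belief X) (x : X) : p x ≤ 1 := by
  rw [← belief_sum p]
  exact Finset.single_le_sum (fun x _ => belief_nonneg p x) (Finset.mem_univ x)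

lemma l1dist_nonneg (p p' : Belief X) : 0 ≤ l1dist p p' :=
  Finset.sum_nonneg fun _ _ => abs_nonneg _

lemma l1dist_comm (p p' : Belief X) : l1dist p p' = l1dist p' p :=
  Finset.sum_congr rfl fun _ _ => abs_sub_comm _ _

lemma l1dist_le_two (p p' : Belief X) : l1dist p p' ≤ 2 := by
  calc l1dist p p' ≤ ∑ x, (p x + p' x) := by
        refine Finset.sum_le_sum fun x _ => ?_
        have h1 := belief_nonneg p x
        have h2 := belief_nonneg p' x
        exact abs_le.mpr ⟨by linarith, by linarith⟩
    _ = 2 := by rw [Finset.sum_add_distrib, belief_sum, belief_sum]; norm_num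

/-- The partition into singletons is the only one needed. Boundedness from below has to be checked
because a real infimum is otherwise meaningless. -/
lemma dobrushin_le [Fintype B] [DecidableEq B] (K : A → Belief B) (a b : A) :
    dobrushin K ≤ ∑ y, min (K a y) (K b y) := by
  have hb : BddBelow (Set.range fun p : (A × A) × Finpartition (Finset.univ : Finset B) =>
      ∑ S ∈ p.2.parts, min (∑ b ∈ S, K p.1.1 b) (∑ b ∈ S, K p.1.2 b)) := by
    refine ⟨0, ?_⟩
    rintro _ ⟨p, rfl⟩
    exact Finset.sum_nonneg fun S _ => le_min
      (Finset.sum_nonneg fun _ _ => belief_nonneg _ _)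
      (Finset.sum_nonneg fun _ _ => belief_nonneg _ _)
  refine (ciInf_le hb ((a, b), ⊥)).trans (le_of_eq ?_)
  simp [Finpartition.parts_bot]

lemma dobrushin_le_one [Nonempty A] [Fintype B] [DecidableEq B] (K : A → Belief B) :
    dobrushin K ≤ 1 := by
  obtain ⟨a⟩ := ‹Nonempty A›
  simpa [belief_sum] using dobrushin_le K a a

lemma l1dist_le_dobrushin [Fintype B] [DecidableEq B] (K : A → Belief B) (a b : A) :
    l1dist (K a) (K b) ≤ 2 * (1 - dobrushin K) := by
  have h : l1dist (K a) (K b) = 2 - 2 * ∑ y, min (K a y) (K b y) := by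
    have h1 : ∀ y, |K a y - K b y| = K a y + K b y - 2 * min (K a y) (K b y) := by
      intro y
      rcases le_total (K a y) (K b y) with h | h
      · rw [min_eq_left h, abs_of_nonpos (by linarith)]; ring
      · rw [min_eq_right h, abs_of_nonneg (by linarith)]; ring
    rw [l1dist, Finset.sum_congr rfl fun y _ => h1 y, Finset.sum_sub_distrib,
      Finset.sum_add_distrib, belief_sum, belief_sum, Finset.mul_sum]
    norm_num
  rw [h]
  linarith [dobrushin_le K a b]

/-- A kernel whose rows are `2 c`-close contracts signed measures of total mass zero. -/
lemma sum_abs_kernel_le [Fintype A] [Fintype B] (K : A → Belief B) (c : ℝ)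
    (hK : ∀ a b, l1dist (K a) (K b) ≤ 2 * c) (v : A → ℝ) (hv : ∑ a, v a = 0) :
    ∑ b, |∑ a, K a b * v a| ≤ c * ∑ a, |v a| := by
  set m := ∑ a, max (v a) 0 with hm
  have hm' : ∑ a, max (-v a) 0 = m := by
    have : ∑ a, (max (v a) 0 - max (-v a) 0) = 0 := by
      refine Eq.trans (Finset.sum_congr rfl fun a _ => ?_) hv
      rcases le_total (v a) 0 with h | h
      · rw [max_eq_right h, max_eq_left (by linarith)]; ring
      · rw [max_eq_left h, max_eq_right (by linarith)]; ring
    rw [Finset.sum_sub_distrib] at this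
    linarith
  have habs : ∑ a, |v a| = 2 * m := by
    have : ∑ a, |v a| = ∑ a, (max (v a) 0 + max (-v a) 0) := by
      refine Finset.sum_congr rfl fun a _ => ?_
      rcases le_total (v a) 0 with h | h
      · rw [max_eq_right h, max_eq_left (by linarith), abs_of_nonpos h]; ring
      · rw [max_eq_left h, max_eq_right (by linarith), abs_of_nonneg h]; ring
    rw [this, Finset.sum_add_distrib, hm', ← hm]; ring
  have hm0 : 0 ≤ m := Finset.sum_nonneg fun a _ => le_max_right _ _
  -- The coupling identity below is multiplied by `m`, to be cancelled at the end, so `m = 0` is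
  -- treated apart.
  rcases hm0.eq_or_lt with h0 | hpos
  · have hz : ∀ a, v a = 0 := by
      intro a
      have := (Finset.sum_eq_zero_iff_of_nonneg (fun a _ => abs_nonneg (v a))).1
        (habs.trans (by rw [← h0]; ring)) a (Finset.mem_univ a)
      exact abs_eq_zero.1 this
    simp [hz]
  -- The positive and negative parts of `v` have the same mass `m`. Their product couples them and
  -- expresses the image of `v` through differences of two rows of `K`.
  have key : ∀ b, m * (∑ a, K a b * v a) =
      ∑ a, ∑ a', max (v a) 0 * max (-v a') 0 * (K a b - K a' b) := by
    intro b
    have e1 : ∀ a, v a = max (v a) 0 - max (-v a) 0 := by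
      intro a
      rcases le_total (v a) 0 with h | h
      · rw [max_eq_right h, max_eq_left (by linarith)]; ring
      · rw [max_eq_left h, max_eq_right (by linarith)]; ring
    have e2 : ∑ a, ∑ a', max (v a) 0 * max (-v a') 0 * K a b
        = m * ∑ a, K a b * max (v a) 0 := by
      rw [Finset.mul_sum]
      refine Finset.sum_congr rfl fun a _ => ?_
      rw [← Finset.sum_mul, ← Finset.mul_sum, hm']; ring
    have e3 : ∑ a, ∑ a', max (v a) 0 * max (-v a') 0 * K a' b
        = m * ∑ a, K a b * max (-v a) 0 := by
      rw [Finset.sum_comm, Finset.mul_sum]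
      refine Finset.sum_congr rfl fun a _ => ?_
      rw [← Finset.sum_mul, ← Finset.sum_mul, ← hm]; ring
    simp_rw [mul_sub, Finset.sum_sub_distrib]
    rw [e2, e3, ← mul_sub, ← Finset.sum_sub_distrib]
    congr 1
    refine Finset.sum_congr rfl fun a _ => ?_
    conv_lhs => rw [e1 a]
    ring
  have hbound : m * ∑ b, |∑ a, K a b * v a| ≤ m * (c * (2 * m)) := by
    calc m * ∑ b, |∑ a, K a b * v a|
        = ∑ b, |m * ∑ a, K a b * v a| := by
          rw [Finset.mul_sum]
          exact Finset.sum_congr rfl fun b _ => by rw [abs_mul, abs_of_pos hpos]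
      _ ≤ ∑ b, ∑ a, ∑ a', max (v a) 0 * max (-v a') 0 * |K a b - K a' b| := by
          refine Finset.sum_le_sum fun b _ => ?_
          rw [key b]
          refine (Finset.abs_sum_le_sum_abs _ _).trans (Finset.sum_le_sum fun a _ => ?_)
          refine (Finset.abs_sum_le_sum_abs _ _).trans (Finset.sum_le_sum fun a' _ => ?_)
          rw [abs_mul, abs_of_nonneg (mul_nonneg (le_max_right _ _) (le_max_right _ _))]
      _ = ∑ a, ∑ a', max (v a) 0 * max (-v a') 0 * l1dist (K a) (K a') := by
          rw [Finset.sum_comm]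
          refine Finset.sum_congr rfl fun a _ => ?_
          rw [Finset.sum_comm]
          exact Finset.sum_congr rfl fun a' _ => by rw [l1dist, Finset.mul_sum]
      _ ≤ ∑ a, ∑ a', max (v a) 0 * max (-v a') 0 * (2 * c) :=
          Finset.sum_le_sum fun a _ => Finset.sum_le_sum fun a' _ =>
            mul_le_mul_of_nonneg_left (hK a a')
              (mul_nonneg (le_max_right _ _) (le_max_right _ _))
      _ = m * (c * (2 * m)) := by
          simp_rw [← Finset.sum_mul, ← Finset.mul_sum, hm']
          rw [← Finset.sum_mul, ← hm]; ring
  rw [habs]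
  exact le_of_mul_le_mul_left hbound hpos

lemma outputProb_sum (O : M → Belief Y) (p : Belief X) (q : Quantizer X M) :
    ∑ y, outputProb O p q y = 1 := by
  unfold outputProb
  rw [Finset.sum_comm]
  simp_rw [← Finset.sum_mul, belief_sum, one_mul]
  exact belief_sum p

/-- The default value in `bayes` does no harm: if the output has probability zero, every term `O (q
x) y * p x` vanishes. Working with this product avoids all divisions later. -/
lemma outputProb_mul_bayes (O : M → Belief Y) (p : Belief X) (y : Y) (q : Quantizer X M) (x : X) :
    outputProb O p q y * bayes O p y q x = O (q x) y * p x := by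
  unfold bayes
  split_ifs with h
  · have := (Finset.sum_eq_zero_iff_of_nonneg
      (fun x _ => mul_nonneg (belief_nonneg (O (q x)) y) (belief_nonneg p x))).1 h x
      (Finset.mem_univ x)
    rw [h, this, zero_mul]
  · exact mul_div_cancel₀ _ h

lemma update_apply (T : X → Belief X) (O : M → Belief Y) (p : Belief X) (y : Y)
    (q : Quantizer X M) (x' : X) :
    update T O p y q x' = ∑ x, T x x' * bayes O p y q x := rfl

lemma outputProb_mul_update (T : X → Belief X) (O : M → Belief Y) (p : Belief X) (y : Y)
    (q : Quantizer X M) (x' : X) :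
    outputProb O p q y * update T O p y q x' = ∑ x, T x x' * (O (q x) y * p x) := by
  rw [update_apply, Finset.mul_sum]
  refine Finset.sum_congr rfl fun x _ => ?_
  rw [← outputProb_mul_bayes]; ring

lemma sum_abs_outputProb_sub_le_mul [Fintype M] [DecidableEq Y] (O : M → Belief Y)
    (p p' : Belief X) (q : Quantizer X M) :
    ∑ y, |outputProb O p q y - outputProb O p' q y| ≤ (1 - dobrushin O) * l1dist p p' := by
  have h := sum_abs_kernel_le (fun x => O (q x)) (1 - dobrushin O)
    (fun a b => l1dist_le_dobrushin O (q a) (q b)) (fun x => p x - p' x)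
    (by rw [Finset.sum_sub_distrib, belief_sum, belief_sum, sub_self])
  refine le_trans (le_of_eq ?_) h
  refine Finset.sum_congr rfl fun y _ => ?_
  simp only [outputProb, mul_sub, Finset.sum_sub_distrib]

lemma sum_abs_outputProb_sub_le (O : M → Belief Y) (p p' : Belief X) (q : Quantizer X M) :
    ∑ y, |outputProb O p q y - outputProb O p' q y| ≤ l1dist p p' := by
  have h := sum_abs_kernel_le (fun x => O (q x)) 1
    (fun a b => by rw [mul_one]; exact l1dist_le_two _ _) (fun x => p x - p' x)
    (by rw [Finset.sum_sub_distrib, belief_sum, belief_sum, sub_self])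
  rw [one_mul] at h
  refine le_trans (le_of_eq ?_) h
  refine Finset.sum_congr rfl fun y _ => ?_
  simp only [outputProb, mul_sub, Finset.sum_sub_distrib]

/-- The difference of the two filters, multiplied by the output probability under `p`, is the
difference of the unnormalized filters minus a correction for the two normalizations. The first
contributes `l1dist p p'`, the second the distance of the output laws, at most `1 - dobrushin O`
times as much; hence the constant `2 - dobrushin O`. -/
lemma sum_outputProb_mul_l1dist_bayes_le [Fintype M] [DecidableEq Y] (O : M → Belief Y)
    (p p' : Belief X) (q : Quantizer X M) :
    ∑ y, outputProb O p q y * l1dist (bayes O p y q) (bayes O p' y q)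
      ≤ (2 - dobrushin O) * l1dist p p' := by
  have h1 : ∀ y, outputProb O p q y * l1dist (bayes O p y q) (bayes O p' y q) ≤
      ∑ x, O (q x) y * |p x - p' x| + |outputProb O p q y - outputProb O p' q y| := by
    intro y
    have e : ∀ x, outputProb O p q y * |bayes O p y q x - bayes O p' y q x| ≤
        O (q x) y * |p x - p' x|
          + |outputProb O p q y - outputProb O p' q y| * bayes O p' y q x := by
      intro x
      have e1 : outputProb O p q y * (bayes O p y q x - bayes O p' y q x) =
          O (q x) y * (p x - p' x)
            - (outputProb O p q y - outputProb O p' q y) * bayes O p' y q x := by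
        have a1 := outputProb_mul_bayes O p y q x
        have a2 := outputProb_mul_bayes O p' y q x
        linear_combination a1 - a2
      calc outputProb O p q y * |bayes O p y q x - bayes O p' y q x|
          = |outputProb O p q y * (bayes O p y q x - bayes O p' y q x)| := by
            rw [abs_mul, abs_of_nonneg (outputProb_nonneg O p q y)]
        _ ≤ _ := by
            rw [e1]
            refine (abs_sub _ _).trans (le_of_eq ?_)
            rw [abs_mul, abs_mul, abs_of_nonneg (belief_nonneg (O (q x)) y),
              abs_of_nonneg (belief_nonneg (bayes O p' y q) x)]
    calc outputProb O p q y * l1dist (bayes O p y q) (bayes O p' y q)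
        = ∑ x, outputProb O p q y * |bayes O p y q x - bayes O p' y q x| := by
          rw [l1dist, Finset.mul_sum]
      _ ≤ _ := Finset.sum_le_sum fun x _ => e x
      _ = _ := by rw [Finset.sum_add_distrib, ← Finset.mul_sum, belief_sum, mul_one]
  calc _ ≤ _ := Finset.sum_le_sum fun y _ => h1 y
    _ = l1dist p p' + ∑ y, |outputProb O p q y - outputProb O p' q y| := by
        rw [Finset.sum_add_distrib, Finset.sum_comm]
        simp_rw [← Finset.sum_mul, belief_sum, one_mul]
        rfl
    _ ≤ _ := by linarith [sum_abs_outputProb_sub_le_mul O p p' q]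

lemma l1dist_push_le [DecidableEq X] (T : X → Belief X) (p p' : Belief X) :
    l1dist (push T p) (push T p') ≤ (1 - dobrushin T) * l1dist p p' := by
  have h := sum_abs_kernel_le T (1 - dobrushin T)
    (fun a b => l1dist_le_dobrushin T a b) (fun x => p x - p' x)
    (by rw [Finset.sum_sub_distrib, belief_sum, belief_sum, sub_self])
  refine le_trans (le_of_eq ?_) h
  refine Finset.sum_congr rfl fun y _ => ?_
  simp only [mul_sub, Finset.sum_sub_distrib]
  rfl

/-- The expected distance of two predictors contracts in one step. -/
lemma sum_outputProb_mul_l1dist_update_le [Nonempty X] [DecidableEq X] [Fintype M] [DecidableEq Y]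
    (T : X → Belief X) (O : M → Belief Y) (p p' : Belief X) (q : Quantizer X M) :
    ∑ y, outputProb O p q y * l1dist (update T O p y q) (update T O p' y q)
      ≤ (1 - dobrushin T) * (2 - dobrushin O) * l1dist p p' := by
  have hT : 0 ≤ 1 - dobrushin T := by linarith [dobrushin_le_one T]
  calc _ ≤ ∑ y, (1 - dobrushin T) *
        (outputProb O p q y * l1dist (bayes O p y q) (bayes O p' y q)) := by
        refine Finset.sum_le_sum fun y _ => ?_
        rw [mul_left_comm]
        exact mul_le_mul_of_nonneg_left (l1dist_push_le T _ _) (outputProb_nonneg O p q y)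
    _ ≤ _ := by
        rw [← Finset.mul_sum, mul_assoc]
        exact mul_le_mul_of_nonneg_left (sum_outputProb_mul_l1dist_bayes_le O p p' q) hT

end Contraction

/-! ### Windows extended by one pair -/

section SnocWindow

variable {X M Y : Type*} {N : ℕ}

/-- The window extended by a new output and a new quantizer. -/
def snocWindow (I : Window X M Y N) (y : Y) (q : Quantizer X M) : Window X M Y (N + 1) :=
  (Fin.snoc I.1 y, Fin.snoc I.2 q)

/-- Windows can be built from the left by `snocWindow`. -/
lemma exists_snocWindow (I : Window X M Y (N + 1)) :
    ∃ (I' : Window X M Y N) (y : Y) (q : Quantizer X M), I = snocWindow I' y q :=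
  ⟨(Fin.init I.1, Fin.init I.2), I.1 (Fin.last N), I.2 (Fin.last N), by simp [snocWindow]⟩

/-- A window of length `N + 1` is a window of length `N` with one more pair. -/
def snocWindowEquiv : Window X M Y N × Y × Quantizer X M ≃ Window X M Y (N + 1) where
  toFun a := snocWindow a.1 a.2.1 a.2.2
  invFun I := ((Fin.init I.1, Fin.init I.2), I.1 (Fin.last N), I.2 (Fin.last N))
  left_inv a := by simp [snocWindow]
  right_inv I := by simp [snocWindow]

end SnocWindow

/-! ### The predictor and its unnormalized version along a window -/

section Windows

variable {X M Y : Type*} [Fintype X] [Fintype Y] {N : ℕ}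

/-- The predictor recursion along the window from its `k`-th pair on. -/
def predictorFrom (T : X → Belief X) (O : M → Belief Y) (k : ℕ) (p : Belief X)
    (I : Window X M Y N) : Belief X :=
  Fin.foldl N (fun p i => if (i : ℕ) < k then p else update T O p (I.1 i) (I.2 i)) p

/-- One step of the unnormalized predictor recursion. -/
def massStep (T : X → Belief X) (O : M → Belief Y) (u : X → ℝ) (y : Y) (q : Quantizer X M) :
    X → ℝ :=
  fun x' => ∑ x, T x x' * (O (q x) y * u x)

/-- The unnormalized predictor recursion along a window. -/
def windowMass (T : X → Belief X) (O : M → Belief Y) (u : X → ℝ) (I : Window X M Y N) : X → ℝ :=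
  Fin.foldl N (fun u i => massStep T O u (I.1 i) (I.2 i)) u

variable (T : X → Belief X) (O : M → Belief Y)

lemma predictorFrom_zero (p : Belief X) (I : Window X M Y N) :
    predictorFrom T O 0 p I = predictor T O (p, I) := by
  simp [predictorFrom, predictor]

lemma predictorFrom_snoc (k : ℕ) (p : Belief X) (I : Window X M Y N) (y : Y)
    (q : Quantizer X M) :
    predictorFrom T O k p (snocWindow I y q) =
      if N < k then predictorFrom T O k p I else update T O (predictorFrom T O k p I) y q := by
  simp [predictorFrom, snocWindow, Fin.foldl_succ_last]

lemma predictor_snoc (p : Belief X) (I : Window X M Y N) (y : Y) (q : Quantizer X M) :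
    predictor T O (p, snocWindow I y q) = update T O (predictor T O (p, I)) y q := by
  simp [← predictorFrom_zero, predictorFrom_snoc]

lemma windowMass_snoc (u : X → ℝ) (I : Window X M Y N) (y : Y) (q : Quantizer X M) :
    windowMass T O u (snocWindow I y q) = massStep T O (windowMass T O u I) y q := by
  simp [windowMass, snocWindow, Fin.foldl_succ_last]

lemma predictorFrom_shiftWindow (k : ℕ) (p : Belief X) (I : Window X M Y N) (y : Y)
    (q : Quantizer X M) :
    predictorFrom T O k p (shiftWindow I y q) =
      predictorFrom T O (k + 1) p (snocWindow I y q) := by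
  simp [predictorFrom, shiftWindow, snocWindow, Fin.foldl_succ, Fin.tail]

/-- The pair that leaves the window is absorbed into the belief coordinate, so nothing is lost: the
current predictor of the window model follows the exact recursion. -/
lemma predictor_nextState (w : WindowState X M Y N) (y : Y) (q : Quantizer X M) :
    predictor T O (nextState T O w y q) = update T O (predictor T O w) y q := by
  rw [← predictor_snoc T O w.1 w.2 y q]
  simp [predictor, nextState, shiftWindow, snocWindow, Fin.foldl_succ, Fin.tail]

/-- The existential pair is the oldest one, which leaves the window. It acts on the starting vector,
where invariance of `ζ` can later be used to discard it. -/
lemma windowMass_shiftWindow (u : X → ℝ) (I : Window X M Y N) (y : Y) (q : Quantizer X M) :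
    ∃ (y₀ : Y) (q₀ : Quantizer X M),
      windowMass T O (massStep T O u y₀ q₀) (shiftWindow I y q) =
        massStep T O (windowMass T O u I) y q := by
  refine ⟨(snocWindow I y q).1 0, (snocWindow I y q).2 0, ?_⟩
  rw [← windowMass_snoc]
  simp [windowMass, shiftWindow, snocWindow, Fin.foldl_succ, Fin.tail]

lemma massStep_mono {u v : X → ℝ} (h : ∀ x, u x ≤ v x) (y : Y) (q : Quantizer X M) (x : X) :
    massStep T O u y q x ≤ massStep T O v y q x :=
  Finset.sum_le_sum fun x' _ => mul_le_mul_of_nonneg_left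
    (mul_le_mul_of_nonneg_left (h x') (belief_nonneg _ _)) (belief_nonneg _ _)

lemma massStep_const_mul (c : ℝ) (u : X → ℝ) (y : Y) (q : Quantizer X M) :
    massStep T O (fun x => c * u x) y q = fun x => c * massStep T O u y q x := by
  funext x
  simp only [massStep, Finset.mul_sum]
  exact Finset.sum_congr rfl fun x' _ => by ring

lemma windowMass_mono {u v : X → ℝ} (h : ∀ x, u x ≤ v x) (I : Window X M Y N) (x : X) :
    windowMass T O u I x ≤ windowMass T O v I x := by
  induction N generalizing x with
  | zero => simpa [windowMass] using h x
  | succ N ih =>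
    obtain ⟨I', y, q, rfl⟩ := exists_snocWindow I
    rw [windowMass_snoc, windowMass_snoc]
    exact massStep_mono T O (ih I') y q x

lemma windowMass_const_mul (c : ℝ) (u : X → ℝ) (I : Window X M Y N) :
    windowMass T O (fun x => c * u x) I = fun x => c * windowMass T O u I x := by
  induction N with
  | zero => simp [windowMass]
  | succ N ih =>
    obtain ⟨I', y, q, rfl⟩ := exists_snocWindow I
    rw [windowMass_snoc, windowMass_snoc, ih I', massStep_const_mul]

lemma windowMass_nonneg {u : X → ℝ} (h : ∀ x, 0 ≤ u x) (I : Window X M Y N) (x : X) :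
    0 ≤ windowMass T O u I x := by
  have := windowMass_mono T O h I x
  have h0 : windowMass T O (fun _ => (0 : ℝ)) I x = 0 := by
    have := congrFun (windowMass_const_mul T O 0 (fun _ => (0 : ℝ)) I) x
    simpa using this
  linarith

lemma massStep_belief (p : Belief X) (y : Y) (q : Quantizer X M) :
    massStep T O p y q = fun x => outputProb O p q y * update T O p y q x := by
  funext x
  rw [outputProb_mul_update]; rfl

lemma sum_massStep (u : X → ℝ) (y : Y) (q : Quantizer X M) :
    ∑ x, massStep T O u y q x = ∑ x, O (q x) y * u x := by
  simp only [massStep]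
  rw [Finset.sum_comm]
  simp_rw [← Finset.sum_mul, belief_sum, one_mul]

/-- The mass recursion is linear and the predictor is its normalization. A window of mass zero
causes no exception, since the unnormalized predictor is then zero. -/
lemma windowMass_eq (p : Belief X) (I : Window X M Y N) :
    windowMass T O p I = fun x => (∑ x', windowMass T O p I x') * predictor T O (p, I) x := by
  induction N with
  | zero => simp [windowMass, predictor]
  | succ N ih =>
    obtain ⟨I', y, q, rfl⟩ := exists_snocWindow I
    rw [windowMass_snoc, ih I', massStep_const_mul, massStep_belief, predictor_snoc]
    funext x
    simp only [← Finset.mul_sum, belief_sum]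
    ring

lemma sum_windowMass_snoc (p : Belief X) (I : Window X M Y N) (y : Y) (q : Quantizer X M) :
    ∑ x, windowMass T O p (snocWindow I y q) x =
      (∑ x, windowMass T O p I x) * outputProb O (predictor T O (p, I)) q y := by
  rw [windowMass_snoc, sum_massStep, outputProb, Finset.mul_sum]
  refine Finset.sum_congr rfl fun x _ => ?_
  conv_lhs => rw [windowMass_eq]
  ring

/-- The test function `h` of the last symbol makes the induction close: summing out the last symbol
replaces `h` by its image under one transition, weighted by the likelihood of the last output. -/
lemma sum_paths (p : X → ℝ) (I : Window X M Y N) (h : X → ℝ) :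
    ∑ x : Fin (N + 1) → X, p (x 0) * (∏ i : Fin N,
        O (I.2 i (x i.castSucc)) (I.1 i) * T (x i.castSucc) (x i.succ)) * h (x (Fin.last N)) =
      ∑ x, windowMass T O p I x * h x := by
  induction N generalizing h with
  | zero =>
    rw [← (Equiv.funUnique (Fin 1) X).symm.sum_comp]
    simp [windowMass]
  | succ N ih =>
    obtain ⟨I', y, q, rfl⟩ := exists_snocWindow I
    rw [← (Fin.snocEquiv fun _ => X).sum_comp, Fintype.sum_prod_type_right]
    have e : ∀ x : Fin (N + 1) → X, ∑ x' : X,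
        p ((Fin.snocEquiv fun _ => X) (x', x) 0) * (∏ i : Fin (N + 1),
          O ((snocWindow I' y q).2 i ((Fin.snocEquiv fun _ => X) (x', x) i.castSucc))
            ((snocWindow I' y q).1 i) *
          T ((Fin.snocEquiv fun _ => X) (x', x) i.castSucc)
            ((Fin.snocEquiv fun _ => X) (x', x) i.succ)) *
          h ((Fin.snocEquiv fun _ => X) (x', x) (Fin.last (N + 1))) =
        p (x 0) * (∏ i : Fin N,
          O (I'.2 i (x i.castSucc)) (I'.1 i) * T (x i.castSucc) (x i.succ)) *
          (O (q (x (Fin.last N))) y * ∑ x', T (x (Fin.last N)) x' * h x') := by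
      intro x
      rw [Finset.mul_sum, Finset.mul_sum]
      refine Finset.sum_congr rfl fun x' _ => ?_
      have h0 : (0 : Fin (N + 2)) = Fin.castSucc (0 : Fin (N + 1)) := rfl
      simp only [Fin.snocEquiv, Equiv.coe_fn_mk, Fin.prod_univ_castSucc, snocWindow,
        Fin.succ_castSucc, Fin.snoc_castSucc, Fin.succ_last, Fin.snoc_last, h0]
      ring
    rw [Finset.sum_congr rfl fun x _ => e x, ih I' fun x =>
      O (q x) y * ∑ x', T x x' * h x', windowMass_snoc]
    simp only [massStep, Finset.mul_sum, Finset.sum_mul]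
    rw [Finset.sum_comm]
    exact Finset.sum_congr rfl fun _ _ => Finset.sum_congr rfl fun _ _ => by ring

open Classical in
lemma initialProb_eq (p : Belief X) (g : InitialPolicy X M Y N) (I : Window X M Y N) :
    initialProb T O p g I =
      if ∀ i : Fin N, I.2 i = g i (fun j => I.1 (Fin.castLE i.isLt.le j))
        (fun j => I.2 (Fin.castLE i.isLt.le j))
      then ∑ x, windowMass T O p I x else 0 := by
  unfold initialProb
  have := sum_paths T O p I fun _ => 1
  simp only [mul_one] at this
  rw [this]

open Classical in
-- The chain rule for initial windows: the arguments of the policy at earlier times do not involve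
-- the last pair, and the last output has its conditional law given the predictor.
lemma initialProb_snoc (p : Belief X) (g : InitialPolicy X M Y (N + 1)) (I : Window X M Y N)
    (y : Y) (q : Quantizer X M) :
    initialProb T O p g (snocWindow I y q) =
      initialProb T O p (fun i => g i.castSucc) I *
        if q = g (Fin.last N) I.1 I.2 then outputProb O (predictor T O (p, I)) q y else 0 := by
  have hc : (∀ i : Fin (N + 1), (snocWindow I y q).2 i =
      g i (fun j => (snocWindow I y q).1 (Fin.castLE i.isLt.le j))
        (fun j => (snocWindow I y q).2 (Fin.castLE i.isLt.le j))) ↔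
      (∀ i : Fin N, I.2 i = g i.castSucc (fun j => I.1 (Fin.castLE i.isLt.le j))
        (fun j => I.2 (Fin.castLE i.isLt.le j))) ∧ q = g (Fin.last N) I.1 I.2 := by
    rw [Fin.forall_fin_succ']
    have e1 : ∀ (i : ℕ) (hi : i ≤ N) (j : Fin i),
        (Fin.castLE (hi.trans N.le_succ) j : Fin (N + 1)) = (Fin.castLE hi j).castSucc :=
      fun _ _ _ => rfl
    have e2 : ∀ (i : ℕ) (hi : i ≤ N) (hi' : i ≤ N + 1), (fun j : Fin i =>
        (snocWindow I y q).1 (Fin.castLE hi' j)) = fun j => I.1 (Fin.castLE hi j) := by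
      intro i hi _
      funext j
      exact Fin.snoc_castSucc (α := fun _ => Y) y I.1 (Fin.castLE hi j)
    have e3 : ∀ (i : ℕ) (hi : i ≤ N) (hi' : i ≤ N + 1), (fun j : Fin i =>
        (snocWindow I y q).2 (Fin.castLE hi' j)) = fun j => I.2 (Fin.castLE hi j) := by
      intro i hi _
      funext j
      exact Fin.snoc_castSucc (α := fun _ => Quantizer X M) q I.2 (Fin.castLE hi j)
    refine and_congr (forall_congr' fun i => ?_) ?_
    · have := e2 i i.isLt.le (i.isLt.le.trans N.le_succ)
      have h3 := e3 i i.isLt.le (i.isLt.le.trans N.le_succ)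
      have hl : (snocWindow I y q).2 i.castSucc = I.2 i :=
        Fin.snoc_castSucc (α := fun _ => Quantizer X M) q I.2 i
      rw [hl]
      exact Eq.congr_right (congrArg₂ (g i.castSucc) this h3)
    · have := e2 N le_rfl N.le_succ
      have h3 := e3 N le_rfl N.le_succ
      have hl : (snocWindow I y q).2 (Fin.last N) = q :=
        Fin.snoc_last (α := fun _ => Quantizer X M) q I.2
      rw [hl]
      exact Eq.congr_right (congrArg₂ (g (Fin.last N)) this h3)
  rw [initialProb_eq, initialProb_eq, sum_windowMass_snoc]
  simp only [hc]
  by_cases h1 : ∀ i : Fin N, I.2 i = g i.castSucc (fun j => I.1 (Fin.castLE i.isLt.le j))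
        (fun j => I.2 (Fin.castLE i.isLt.le j))
  · by_cases h2 : q = g (Fin.last N) I.1 I.2
    · rw [if_pos ⟨h1, h2⟩, if_pos h2]
      exact congrArg (· * _) (if_pos h1).symm
    · rw [if_neg fun h => h2 h.2, if_neg h2, mul_zero]
  · rw [if_neg fun h => h1 h.1]
    exact (mul_eq_zero_of_left (if_neg h1) _).symm

lemma initialProb_nonneg (p : Belief X) (g : InitialPolicy X M Y N) (I : Window X M Y N) :
    0 ≤ initialProb T O p g I := by
  classical
  rw [initialProb_eq]
  split_ifs
  · exact Finset.sum_nonneg fun x _ => windowMass_nonneg T O (belief_nonneg p) I x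
  · exact le_rfl

/-! ### Filter stability in expectation -/

lemma kernel_rate_nonneg [Nonempty X] [DecidableEq X] [Nonempty M] [DecidableEq Y] :
    0 ≤ (1 - dobrushin T) * (2 - dobrushin O) :=
  mul_nonneg (by linarith [dobrushin_le_one T]) (by linarith [dobrushin_le_one O])

/-- A bound for the expected discounted sum of the distances between the true predictor and the
one that starts from `ζ` at the beginning of the window; it holds under every policy. -/
def stabilityPotential [DecidableEq X] [DecidableEq Y] (β : ℝ) (ζ : Belief X) (w : WindowState X M Y N) : ℝ :=
  -- In `k < N` steps the window will start at the present `k`-th pair, and the present distance to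
  -- the recursion started there from `ζ` will have contracted `k` times. From step `N` on, the
  -- distance is at most 2 at the start of the window and contracts `N` times; these terms form the
  -- geometric tail.
  ∑ k ∈ Finset.range N, (β * ((1 - dobrushin T) * (2 - dobrushin O))) ^ k *
      l1dist (predictor T O w) (predictorFrom T O k ζ w.2) +
    2 * (β * ((1 - dobrushin T) * (2 - dobrushin O))) ^ N / (1 - β)

lemma stabilityPotential_nonneg [Nonempty X] [Nonempty M] [DecidableEq X] [DecidableEq Y] {β : ℝ} (hβ0 : 0 < β)
    (hβ1 : β < 1) (ζ : Belief X) (w : WindowState X M Y N) :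
    0 ≤ stabilityPotential T O β ζ w := by
  have ha := mul_nonneg hβ0.le (kernel_rate_nonneg T O)
  have hb : 0 < 1 - β := by linarith
  exact add_nonneg (Finset.sum_nonneg fun k _ => mul_nonneg (pow_nonneg ha k) (l1dist_nonneg _ _))
    (div_nonneg (mul_nonneg zero_le_two (pow_nonneg ha N)) hb.le)

variable [DecidableEq X] [Fintype M]

lemma sum_window_succ (f : Window X M Y (N + 1) → ℝ) :
    ∑ I, f I = ∑ I : Window X M Y N, ∑ y, ∑ q, f (snocWindow I y q) := by
  rw [← snocWindowEquiv.sum_comp, Fintype.sum_prod_type]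
  exact Finset.sum_congr rfl fun I _ => Fintype.sum_prod_type _

lemma sum_initialProb_succ (p : Belief X) (g : InitialPolicy X M Y (N + 1))
    (f : Window X M Y (N + 1) → ℝ) :
    ∑ I, initialProb T O p g I * f I = ∑ I : Window X M Y N,
      initialProb T O p (fun i => g i.castSucc) I * ∑ y,
        outputProb O (predictor T O (p, I)) (g (Fin.last N) I.1 I.2) y *
          f (snocWindow I y (g (Fin.last N) I.1 I.2)) := by
  classical
  rw [sum_window_succ]
  refine Finset.sum_congr rfl fun I _ => ?_
  rw [Finset.mul_sum]
  refine Finset.sum_congr rfl fun y _ => ?_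
  simp_rw [initialProb_snoc]
  rw [Finset.sum_eq_single (g (Fin.last N) I.1 I.2)]
  · rw [if_pos rfl]; ring
  · intro q _ hq
    rw [if_neg hq]; ring
  · simp

lemma sum_initialProb (p : Belief X) (g : InitialPolicy X M Y N) :
    ∑ I, initialProb T O p g I = 1 := by
  induction N with
  | zero =>
    classical
    rw [Fintype.sum_subsingleton _ (Fin.elim0, Fin.elim0), initialProb_eq,
      if_pos fun i => i.elim0]
    simp [windowMass]
  | succ N ih =>
    have := sum_initialProb_succ T O p g fun _ => 1
    simp only [mul_one] at this
    rw [this]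
    simp_rw [outputProb_sum, mul_one]
    exact ih _

/-- The second recursion waits until the `k`-th pair. At that moment the distance is at most 2,
whatever happened before, and `N - k` contracting steps remain. -/
lemma initialExp_l1dist_le [Nonempty X] [Nonempty M] [DecidableEq Y] (p p' : Belief X)
    (g : InitialPolicy X M Y N) (k : ℕ) (hk : k ≤ N) :
    ∑ I, initialProb T O p g I * l1dist (predictor T O (p, I)) (predictorFrom T O k p' I) ≤
      2 * ((1 - dobrushin T) * (2 - dobrushin O)) ^ (N - k) := by
  have ha : 0 ≤ (1 - dobrushin T) * (2 - dobrushin O) :=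
    mul_nonneg (by linarith [dobrushin_le_one T]) (by linarith [dobrushin_le_one O])
  have htop : ∀ (n : ℕ) (g : InitialPolicy X M Y n) (r : Window X M Y n → Belief X),
      ∑ I, initialProb T O p g I * l1dist (predictor T O (p, I)) (r I) ≤ 2 := by
    intro n g r
    calc _ ≤ ∑ I, initialProb T O p g I * 2 := Finset.sum_le_sum fun I _ =>
          mul_le_mul_of_nonneg_left (l1dist_le_two _ _) (initialProb_nonneg T O p g I)
      _ = 2 := by rw [← Finset.sum_mul, sum_initialProb, one_mul]
  induction N with
  | zero =>
    obtain rfl : k = 0 := by omega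
    simpa using htop 0 g _
  | succ N ih =>
    rcases hk.eq_or_lt with rfl | hlt
    · simpa using htop (N + 1) g _
    · have hk' : k ≤ N := by omega
      rw [sum_initialProb_succ]
      have e : N + 1 - k = N - k + 1 := by omega
      rw [e, pow_succ]
      calc _ ≤ ∑ I : Window X M Y N, initialProb T O p (fun i => g i.castSucc) I *
            ((1 - dobrushin T) * (2 - dobrushin O) *
              l1dist (predictor T O (p, I)) (predictorFrom T O k p' I)) := by
            refine Finset.sum_le_sum fun I _ => mul_le_mul_of_nonneg_left ?_
              (initialProb_nonneg T O p _ I)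
            simp_rw [predictor_snoc, predictorFrom_snoc, if_neg (not_lt.2 hk')]
            exact sum_outputProb_mul_l1dist_update_le T O _ _ _
        _ = (1 - dobrushin T) * (2 - dobrushin O) * ∑ I : Window X M Y N,
              initialProb T O p (fun i => g i.castSucc) I *
              l1dist (predictor T O (p, I)) (predictorFrom T O k p' I) := by
            rw [Finset.mul_sum]
            exact Finset.sum_congr rfl fun I _ => by ring
        _ ≤ _ := by
            refine (mul_le_mul_of_nonneg_left (ih (fun i => g i.castSucc) hk') ha).trans
              (le_of_eq (by ring))

/-- After one step the `k`-th term of the potential is controlled by the `(k + 1)`-st term before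
it, because the window shifts by one pair. The sum telescopes, the term of index zero pays for the
present distance, and the new term of index `N` is covered by the tail. -/
lemma stabilityPotential_step [Nonempty X] [Nonempty M] [DecidableEq Y] {β : ℝ} (hβ0 : 0 < β)
    (hβ1 : β < 1) (ζ : Belief X) (w : WindowState X M Y N) (q : Quantizer X M) :
    l1dist (predictor T O w) (predictor T O (ζ, w.2)) +
      β * ∑ y, outputProb O (predictor T O w) q y *
        stabilityPotential T O β ζ (nextState T O w y q) ≤
      stabilityPotential T O β ζ w := by
  set a := (1 - dobrushin T) * (2 - dobrushin O) with ha
  have ha0 : 0 ≤ a := kernel_rate_nonneg T O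
  have hb : 0 < 1 - β := by linarith
  set D : ℕ → ℝ := fun k => l1dist (predictor T O w) (predictorFrom T O k ζ w.2) with hD
  have hD2 : D N ≤ 2 := l1dist_le_two _ _
  have h1 : ∑ y, outputProb O (predictor T O w) q y *
        stabilityPotential T O β ζ (nextState T O w y q) ≤
      ∑ k ∈ Finset.range N, (β * a) ^ k * (a * D (k + 1)) + 2 * (β * a) ^ N / (1 - β) := by
    simp_rw [stabilityPotential, mul_add, Finset.sum_add_distrib]
    rw [← Finset.sum_mul, outputProb_sum, one_mul]
    refine add_le_add ?_ le_rfl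
    simp_rw [Finset.mul_sum]
    rw [Finset.sum_comm]
    refine Finset.sum_le_sum fun k hk => ?_
    have hk' : k + 1 ≤ N := Finset.mem_range.1 hk
    simp_rw [mul_left_comm _ ((β * _) ^ k)]
    rw [← Finset.mul_sum]
    refine mul_le_mul_of_nonneg_left ?_ (pow_nonneg (mul_nonneg hβ0.le ha0) k)
    have e : ∀ y, (nextState T O w y q).2 = shiftWindow w.2 y q := fun _ => rfl
    simp_rw [predictor_nextState, e, predictorFrom_shiftWindow, predictorFrom_snoc,
      if_neg (not_lt.2 hk')]
    exact sum_outputProb_mul_l1dist_update_le T O _ _ _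
  have h2 : ∑ k ∈ Finset.range N, (β * a) ^ (k + 1) * D (k + 1) + D 0 =
      ∑ k ∈ Finset.range N, (β * a) ^ k * D k + (β * a) ^ N * D N := by
    rw [← Finset.sum_range_succ, Finset.sum_range_succ']; simp
  have h3 : β * ∑ k ∈ Finset.range N, (β * a) ^ k * (a * D (k + 1)) =
      ∑ k ∈ Finset.range N, (β * a) ^ (k + 1) * D (k + 1) := by
    rw [Finset.mul_sum]
    exact Finset.sum_congr rfl fun k _ => by ring
  have h4 : 2 * (β * a) ^ N / (1 - β) = 2 * (β * a) ^ N + β * (2 * (β * a) ^ N / (1 - β)) := by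
    field_simp; ring
  have h5 : (β * a) ^ N * D N ≤ 2 * (β * a) ^ N := by
    rw [mul_comm]
    exact mul_le_mul_of_nonneg_right hD2 (pow_nonneg (mul_nonneg hβ0.le ha0) N)
  have h6 : l1dist (predictor T O w) (predictor T O (ζ, w.2)) = D 0 := by
    simp only [hD, predictorFrom_zero]
  have h7 : stabilityPotential T O β ζ w =
      ∑ k ∈ Finset.range N, (β * a) ^ k * D k + 2 * (β * a) ^ N / (1 - β) := rfl
  rw [h6, h7]
  have h8 := mul_le_mul_of_nonneg_left h1 hβ0.le
  rw [mul_add, h3] at h8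
  linarith

/-- The discount factor `(β * a) ^ k` of the `k`-th term meets an expected distance of at most `2 *
a ^ (N - k)`, so each term is at most `2 * β ^ k * a ^ N`; with the tail this is a full geometric
series. -/
lemma initialExp_stabilityPotential_le [Nonempty X] [Nonempty M] [DecidableEq Y] {β : ℝ}
    (hβ0 : 0 < β) (hβ1 : β < 1) (ζ p : Belief X) (g : InitialPolicy X M Y N) :
    initialExp T O p g (stabilityPotential T O β ζ) ≤
      2 / (1 - β) * ((1 - dobrushin T) * (2 - dobrushin O)) ^ N := by
  set a := (1 - dobrushin T) * (2 - dobrushin O) with ha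
  have ha0 : 0 ≤ a := kernel_rate_nonneg T O
  have hb : 0 < 1 - β := by linarith
  have h1 : initialExp T O p g (stabilityPotential T O β ζ) =
      ∑ k ∈ Finset.range N, (β * a) ^ k * (∑ I, initialProb T O p g I *
        l1dist (predictor T O (p, I)) (predictorFrom T O k ζ I)) +
      2 * (β * a) ^ N / (1 - β) := by
    simp_rw [initialExp, stabilityPotential, mul_add, Finset.sum_add_distrib]
    rw [← Finset.sum_mul, sum_initialProb, one_mul]
    congr 1
    simp_rw [Finset.mul_sum]
    rw [Finset.sum_comm]
    exact Finset.sum_congr rfl fun k _ => Finset.sum_congr rfl fun I _ => by ring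
  have h2 : ∑ k ∈ Finset.range N, (β * a) ^ k * (∑ I, initialProb T O p g I *
        l1dist (predictor T O (p, I)) (predictorFrom T O k ζ I)) ≤
      ∑ k ∈ Finset.range N, β ^ k * (2 * a ^ N) := by
    refine Finset.sum_le_sum fun k hk => ?_
    have hk' : k ≤ N := (Finset.mem_range.1 hk).le
    refine (mul_le_mul_of_nonneg_left (initialExp_l1dist_le T O p ζ g k hk')
      (pow_nonneg (mul_nonneg hβ0.le ha0) k)).trans (le_of_eq ?_)
    rw [← ha, mul_pow]
    have : a ^ k * a ^ (N - k) = a ^ N := by rw [← pow_add]; congr 1; omega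
    rw [← this]; ring
  have h3 : (∑ k ∈ Finset.range N, β ^ k) * (1 - β) = 1 - β ^ N := geom_sum_mul_neg β N
  rw [← Finset.sum_mul] at h2
  have h4 : (∑ k ∈ Finset.range N, β ^ k) * (2 * a ^ N) + 2 * (β * a) ^ N / (1 - β) =
      2 / (1 - β) * a ^ N := by
    rw [eq_div_of_mul_eq hb.ne' h3, mul_pow β a N]
    field_simp; ring
  linarith

end Windows

/-! ### The discounted optimality equation on a finite state space -/

section Bellman

variable {Z U Y : Type*} [Fintype U] [Nonempty U]

lemma abs_inf'_sub_inf'_le {f g : U → ℝ} {L : ℝ} (h : ∀ v, |f v - g v| ≤ L) :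
    |Finset.univ.inf' Finset.univ_nonempty f - Finset.univ.inf' Finset.univ_nonempty g| ≤ L := by
  have key : ∀ f g : U → ℝ, (∀ v, |f v - g v| ≤ L) →
      Finset.univ.inf' Finset.univ_nonempty f ≤ Finset.univ.inf' Finset.univ_nonempty g + L := by
    intro f g h
    obtain ⟨v, hv, e⟩ := Finset.exists_mem_eq_inf' (Finset.univ_nonempty (α := U)) g
    rw [e]
    refine (Finset.inf'_le f hv).trans ?_
    linarith [(abs_le.1 (h v)).2]
  have h1 := key f g h
  have h2 := key g f fun v => by rw [abs_sub_comm]; exact h v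
  exact abs_le.mpr ⟨by linarith, by linarith⟩

/-- The discounted optimality equation of a finite Markov decision process has a bounded
solution. -/
lemma exists_optimality_equation [Fintype Z] [Fintype Y] {β : ℝ} (hβ0 : 0 < β) (hβ1 : β < 1)
    (c : Z → U → ℝ) {C : ℝ} (hc0 : ∀ z u, 0 ≤ c z u) (hc1 : ∀ z u, c z u ≤ C)
    (P : Z → U → Y → ℝ) (hP0 : ∀ z u y, 0 ≤ P z u y) (hP1 : ∀ z u, ∑ y, P z u y = 1)
    (nx : Z → U → Y → Z) :
    ∃ V : Z → U → ℝ,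
      (∀ z u, V z u = c z u +
        β * ∑ y, P z u y * Finset.univ.inf' Finset.univ_nonempty (V (nx z u y))) ∧
      ∀ z u, 0 ≤ V z u ∧ V z u ≤ C / (1 - β) := by
  have hb : 0 < 1 - β := by linarith
  let Φ : (Z → U → ℝ) → Z → U → ℝ := fun V z u => c z u +
    β * ∑ y, P z u y * Finset.univ.inf' Finset.univ_nonempty (V (nx z u y))
  have hΦ : ContractingWith ⟨β, hβ0.le⟩ Φ := by
    refine ⟨by exact_mod_cast hβ1, LipschitzWith.of_dist_le_mul fun V W => ?_⟩
    have hr : 0 ≤ β * dist V W := mul_nonneg hβ0.le dist_nonneg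
    refine (dist_pi_le_iff hr).2 fun z => (dist_pi_le_iff hr).2 fun u => ?_
    have e : Φ V z u - Φ W z u = β * ∑ y, P z u y *
        (Finset.univ.inf' Finset.univ_nonempty (V (nx z u y)) -
          Finset.univ.inf' Finset.univ_nonempty (W (nx z u y))) := by
      simp only [Φ, mul_sub, Finset.sum_sub_distrib]; ring
    rw [Real.dist_eq, e, abs_mul, abs_of_pos hβ0]
    refine mul_le_mul_of_nonneg_left ?_ hβ0.le
    calc _ ≤ ∑ y, P z u y * dist V W := by
          refine (Finset.abs_sum_le_sum_abs _ _).trans (Finset.sum_le_sum fun y _ => ?_)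
          rw [abs_mul, abs_of_nonneg (hP0 z u y)]
          refine mul_le_mul_of_nonneg_left (abs_inf'_sub_inf'_le fun v => ?_) (hP0 z u y)
          rw [← Real.dist_eq]
          exact (dist_le_pi_dist _ _ v).trans (dist_le_pi_dist V W _)
      _ = dist V W := by rw [← Finset.sum_mul, hP1, one_mul]
  have hfix : Φ hΦ.fixedPoint = hΦ.fixedPoint := hΦ.fixedPoint_isFixedPt
  set V := hΦ.fixedPoint with hVdef
  have hV : ∀ z u, V z u = c z u +
      β * ∑ y, P z u y * Finset.univ.inf' Finset.univ_nonempty (V (nx z u y)) :=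
    fun z u => (congrFun (congrFun hfix z) u).symm
  refine ⟨V, hV, fun z u => ⟨?_, ?_⟩⟩
  · have : Nonempty (Z × U) := ⟨(z, u)⟩
    obtain ⟨a, ha⟩ := Finite.exists_min fun a : Z × U => V a.1 a.2
    -- At a minimal entry of `V` the averaged future value is at least that entry, so the equation
    -- gives `(1 - β) * V ≥ c ≥ 0` there. The upper bound is read off at a maximal entry in the same
    -- way.
    have h1 : V a.1 a.2 ≤ ∑ y, P a.1 a.2 y *
        Finset.univ.inf' Finset.univ_nonempty (V (nx a.1 a.2 y)) := by
      calc V a.1 a.2 = ∑ y, P a.1 a.2 y * V a.1 a.2 := by rw [← Finset.sum_mul, hP1, one_mul]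
        _ ≤ _ := Finset.sum_le_sum fun y _ => mul_le_mul_of_nonneg_left
            (Finset.le_inf' _ _ fun v _ => ha (_, v)) (hP0 _ _ _)
    have h2 := hV a.1 a.2
    have h3 := hc0 a.1 a.2
    have h4 := mul_le_mul_of_nonneg_left h1 hβ0.le
    have h5 : 0 ≤ (1 - β) * V a.1 a.2 := by linarith
    exact (nonneg_of_mul_nonneg_right h5 hb).trans (ha (z, u))
  · have : Nonempty (Z × U) := ⟨(z, u)⟩
    obtain ⟨a, ha⟩ := Finite.exists_max fun a : Z × U => V a.1 a.2
    have h1 : ∑ y, P a.1 a.2 y * Finset.univ.inf' Finset.univ_nonempty (V (nx a.1 a.2 y)) ≤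
        V a.1 a.2 := by
      calc _ ≤ ∑ y, P a.1 a.2 y * V a.1 a.2 :=
            Finset.sum_le_sum fun y _ => mul_le_mul_of_nonneg_left
              ((Finset.inf'_le _ (Finset.mem_univ (Classical.arbitrary U))).trans
                (ha (_, _))) (hP0 _ _ _)
        _ = V a.1 a.2 := by rw [← Finset.sum_mul, hP1, one_mul]
    have h2 := hV a.1 a.2
    have h3 := hc1 a.1 a.2
    have h4 := mul_le_mul_of_nonneg_left h1 hβ0.le
    refine (ha (z, u)).trans ((le_div_iff₀ hb).2 ?_)
    linarith

end Bellman

/-! ### Bounds for the stage cost -/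

section Cost

variable {X M Y Xh : Type*} [Fintype X] [Nonempty X] [Fintype Y] [Fintype Xh] [Nonempty Xh]
  (O : M → Belief Y) {d : X → Xh → ℝ} (hd : ∀ x xh, 0 ≤ d x xh)

omit [Nonempty X] in
include hd in
lemma stageCost_nonneg (p : Belief X) (q : Quantizer X M) : 0 ≤ stageCost O d p q :=
  Finset.sum_nonneg fun _ _ => Finset.le_inf' _ _ fun xh _ => Finset.sum_nonneg fun x _ =>
    mul_nonneg (mul_nonneg (hd x xh) (belief_nonneg _ _)) (belief_nonneg _ _)

lemma le_distNorm (d : X → Xh → ℝ) (x : X) (xh : Xh) : d x xh ≤ distNorm d :=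
  Finset.le_sup' (fun p : X × Xh => d p.1 p.2) (Finset.mem_univ (x, xh))

include hd in
lemma distNorm_nonneg : 0 ≤ distNorm d :=
  (hd (Classical.arbitrary X) (Classical.arbitrary Xh)).trans (le_distNorm d _ _)

lemma stageCost_le (p : Belief X) (q : Quantizer X M) : stageCost O d p q ≤ distNorm d := by
  calc stageCost O d p q ≤ ∑ y, ∑ x, distNorm d * (O (q x) y * p x) := by
        refine Finset.sum_le_sum fun y _ =>
          (Finset.inf'_le _ (Finset.mem_univ (Classical.arbitrary Xh))).trans
            (Finset.sum_le_sum fun x _ => ?_)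
        rw [mul_assoc]
        exact mul_le_mul_of_nonneg_right (le_distNorm d x _)
          (mul_nonneg (belief_nonneg _ _) (belief_nonneg _ _))
    _ = distNorm d := by
        rw [Finset.sum_comm]
        simp_rw [← Finset.mul_sum, ← Finset.sum_mul, belief_sum, one_mul]
        rw [belief_sum, mul_one]

include hd in
-- For each output, the reproduction symbol that is optimal for `p'` is also tried for `p`.
lemma stageCost_le_add (p p' : Belief X) (q : Quantizer X M) :
    stageCost O d p q ≤ stageCost O d p' q + distNorm d * l1dist p p' := by
  have h : ∀ y, (Finset.univ.inf' Finset.univ_nonempty fun xh : Xh =>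
        ∑ x, d x xh * O (q x) y * p x) ≤
      (Finset.univ.inf' Finset.univ_nonempty fun xh : Xh => ∑ x, d x xh * O (q x) y * p' x) +
        ∑ x, distNorm d * (O (q x) y * |p x - p' x|) := by
    intro y
    obtain ⟨xh, hxh, e⟩ := Finset.exists_mem_eq_inf' (Finset.univ_nonempty (α := Xh))
      fun xh : Xh => ∑ x, d x xh * O (q x) y * p' x
    rw [e]
    refine (Finset.inf'_le _ hxh).trans ?_
    rw [← Finset.sum_add_distrib]
    refine Finset.sum_le_sum fun x _ => ?_
    have h1 : d x xh * O (q x) y * (p x - p' x) ≤ distNorm d * (O (q x) y * |p x - p' x|) := by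
      rw [mul_assoc]
      refine (mul_le_mul_of_nonneg_left (mul_le_mul_of_nonneg_left (le_abs_self _)
        (belief_nonneg _ _)) (hd x xh)).trans ?_
      exact mul_le_mul_of_nonneg_right (le_distNorm d x xh)
        (mul_nonneg (belief_nonneg _ _) (abs_nonneg _))
    linarith
  calc stageCost O d p q ≤ _ := Finset.sum_le_sum fun y _ => h y
    _ = stageCost O d p' q + distNorm d * l1dist p p' := by
        rw [Finset.sum_add_distrib]
        congr 1
        rw [Finset.sum_comm]
        simp_rw [← Finset.mul_sum, ← Finset.sum_mul, belief_sum, one_mul]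
        rfl

include hd in
lemma abs_stageCost_sub_le (p p' : Belief X) (q : Quantizer X M) :
    |stageCost O d p q - stageCost O d p' q| ≤ distNorm d * l1dist p p' := by
  have h1 := stageCost_le_add O hd p p' q
  have h2 := stageCost_le_add O hd p' p q
  rw [l1dist_comm] at h2
  exact abs_le.mpr ⟨by linarith, by linarith⟩

end Cost

/-! ### Discounted costs through finite horizons -/

section DiscountedCost

variable {X M Y Xh : Type*} [Fintype X] [Nonempty X] [Fintype Y] [Fintype Xh] [Nonempty Xh] {N : ℕ}
  (T : X → Belief X) (O : M → Belief Y) {d : X → Xh → ℝ} (hd : ∀ x xh, 0 ≤ d x xh) {β : ℝ}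
  (g : WindowState X M Y N → Quantizer X M)

/-- The discounted cost of the first `n` stages. -/
def truncatedCost (d : X → Xh → ℝ) (β : ℝ) (n : ℕ) (w : WindowState X M Y N) : ℝ :=
  ∑ t ∈ Finset.range n, β ^ t *
    ((stepExp T O g)^[t] fun v => stageCost O d (predictor T O v) (g v)) w

omit [Nonempty X] in
-- This first-step recursion lets every comparison of costs run by induction on the horizon.
lemma truncatedCost_succ (n : ℕ) (w : WindowState X M Y N) :
    truncatedCost T O g d β (n + 1) w = stageCost O d (predictor T O w) (g w) +
      β * ∑ y, outputProb O (predictor T O w) (g w) y *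
        truncatedCost T O g d β n (nextState T O w y (g w)) := by
  rw [truncatedCost, Finset.sum_range_succ', add_comm]
  congr 1
  · simp
  · simp_rw [Function.iterate_succ_apply', truncatedCost, stepExp, Finset.mul_sum]
    rw [Finset.sum_comm]
    exact Finset.sum_congr rfl fun y _ => Finset.sum_congr rfl fun t _ => by ring

include hd in
lemma iterate_stepExp_mem (t : ℕ) (w : WindowState X M Y N) :
    ((stepExp T O g)^[t] fun v => stageCost O d (predictor T O v) (g v)) w ∈
      Set.Icc 0 (distNorm d) := by
  induction t generalizing w with
  | zero => exact ⟨stageCost_nonneg O hd _ _, stageCost_le O _ _⟩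
  | succ t ih =>
    rw [Function.iterate_succ_apply']
    refine ⟨Finset.sum_nonneg fun y _ => mul_nonneg (outputProb_nonneg _ _ _ _) (ih _).1, ?_⟩
    calc _ ≤ ∑ y, outputProb O (predictor T O w) (g w) y * distNorm d :=
          Finset.sum_le_sum fun y _ => mul_le_mul_of_nonneg_left (ih _).2
            (outputProb_nonneg _ _ _ _)
      _ = distNorm d := by rw [← Finset.sum_mul, outputProb_sum, one_mul]

include hd in
lemma summable_discountedCost (hβ0 : 0 < β) (hβ1 : β < 1) (w : WindowState X M Y N) :
    Summable fun t : ℕ => β ^ t *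
      ((stepExp T O g)^[t] fun v => stageCost O d (predictor T O v) (g v)) w := by
  refine Summable.of_nonneg_of_le
    (fun t => mul_nonneg (pow_nonneg hβ0.le t) (iterate_stepExp_mem T O hd g t w).1)
    (fun t => mul_le_mul_of_nonneg_left (iterate_stepExp_mem T O hd g t w).2
      (pow_nonneg hβ0.le t))
    ((summable_geometric_of_lt_one hβ0.le hβ1).mul_right _)

include hd in
lemma truncatedCost_le_discountedCost (hβ0 : 0 < β) (hβ1 : β < 1) (n : ℕ)
    (w : WindowState X M Y N) :
    truncatedCost T O g d β n w ≤ discountedCost T O d β w g :=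
  (summable_discountedCost T O hd g hβ0 hβ1 w).sum_le_tsum _
    fun t _ => mul_nonneg (pow_nonneg hβ0.le t) (iterate_stepExp_mem T O hd g t w).1

include hd in
lemma discountedCost_le_of_truncatedCost_le (hβ0 : 0 < β) (hβ1 : β < 1) {b : ℝ}
    (w : WindowState X M Y N) (h : ∀ n, truncatedCost T O g d β n w ≤ b) :
    discountedCost T O d β w g ≤ b :=
  (summable_discountedCost T O hd g hβ0 hβ1 w).tsum_le_of_sum_range_le h

end DiscountedCost

/-! ### Loss of the greedy policy of the frozen model -/

section Performance

variable {X M Y Xh : Type*} [Fintype X] [Nonempty X] [DecidableEq X] [Fintype M] [Nonempty M]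
  [Fintype Y] [DecidableEq Y] [Fintype Xh] [Nonempty Xh] {N : ℕ}
  (T : X → Belief X) (O : M → Belief Y) {d : X → Xh → ℝ} (hd : ∀ x xh, 0 ≤ d x xh)
  {β : ℝ} (hβ0 : 0 < β) (hβ1 : β < 1) (ζ : Belief X)

/-- The optimality equation of the finite model in which the belief at the beginning of the
window is frozen at `ζ`. -/
def IsWindowValue (d : X → Xh → ℝ) (β : ℝ) (V : Window X M Y N → Quantizer X M → ℝ) : Prop :=
  ∀ I q, V I q = stageCost O d (predictor T O (ζ, I)) q +
    β * ∑ y, outputProb O (predictor T O (ζ, I)) q y *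
      Finset.univ.inf' Finset.univ_nonempty (V (shiftWindow I y q))

omit [DecidableEq Y] in
include hd hβ0 hβ1 in
lemma exists_isWindowValue : ∃ V : Window X M Y N → Quantizer X M → ℝ,
    IsWindowValue T O ζ d β V ∧ ∀ I q, 0 ≤ V I q ∧ V I q ≤ distNorm d / (1 - β) :=
  exists_optimality_equation hβ0 hβ1 (fun I q => stageCost O d (predictor T O (ζ, I)) q)
    (fun _ _ => stageCost_nonneg O hd _ _) (fun _ _ => stageCost_le O _ _)
    (fun I q y => outputProb O (predictor T O (ζ, I)) q y) (fun _ _ _ => outputProb_nonneg _ _ _ _)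
    (fun _ _ => outputProb_sum _ _ _) (fun I q y => shiftWindow I y q)

variable {V : Window X M Y N → Quantizer X M → ℝ} (hV : IsWindowValue T O ζ d β V)
  (hVb : ∀ I q, 0 ≤ V I q ∧ V I q ≤ distNorm d / (1 - β))

omit [Fintype Y] [DecidableEq Y] in
include hVb in
lemma inf'_windowValue_mem (I : Window X M Y N) :
    Finset.univ.inf' Finset.univ_nonempty (V I) ∈ Set.Icc 0 (distNorm d / (1 - β)) :=
  ⟨Finset.le_inf' _ _ fun q _ => (hVb I q).1,
    (Finset.inf'_le _ (Finset.mem_univ (Classical.arbitrary (Quantizer X M)))).trans (hVb I _).2⟩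

omit [DecidableEq Y] in
include hd hβ0 hβ1 hV hVb in
/-- The error of the finite model in one step. -/
lemma abs_bellman_sub_windowValue_le (w : WindowState X M Y N) (q : Quantizer X M) :
    |stageCost O d (predictor T O w) q + β * ∑ y, outputProb O (predictor T O w) q y *
        Finset.univ.inf' Finset.univ_nonempty (V (shiftWindow w.2 y q)) - V w.2 q| ≤
      distNorm d / (1 - β) * l1dist (predictor T O w) (predictor T O (ζ, w.2)) := by
  have hb : 0 < 1 - β := by linarith
  set p := predictor T O w
  set p' := predictor T O (ζ, w.2)
  have h1 := abs_stageCost_sub_le O hd p p' q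
  have h2 : |∑ y, (outputProb O p q y - outputProb O p' q y) *
      Finset.univ.inf' Finset.univ_nonempty (V (shiftWindow w.2 y q))| ≤
      distNorm d / (1 - β) * l1dist p p' := by
    calc _ ≤ ∑ y, |outputProb O p q y - outputProb O p' q y| * (distNorm d / (1 - β)) := by
          refine (Finset.abs_sum_le_sum_abs _ _).trans (Finset.sum_le_sum fun y _ => ?_)
          have hm := inf'_windowValue_mem hVb (shiftWindow w.2 y q)
          rw [abs_mul, abs_of_nonneg hm.1]
          exact mul_le_mul_of_nonneg_left hm.2 (abs_nonneg _)
      _ ≤ _ := by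
          rw [← Finset.sum_mul, mul_comm]
          exact mul_le_mul_of_nonneg_left (sum_abs_outputProb_sub_le O p p' q)
            (div_nonneg (distNorm_nonneg hd) hb.le)
  have e : stageCost O d p q + β * ∑ y, outputProb O p q y *
        Finset.univ.inf' Finset.univ_nonempty (V (shiftWindow w.2 y q)) - V w.2 q =
      (stageCost O d p q - stageCost O d p' q) +
        β * ∑ y, (outputProb O p q y - outputProb O p' q y) *
          Finset.univ.inf' Finset.univ_nonempty (V (shiftWindow w.2 y q)) := by
    rw [hV w.2 q]
    simp only [sub_mul, Finset.sum_sub_distrib]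
    ring
  rw [e]
  -- The error in the stage cost has constant `distNorm d`, the error in the transition law `β *
  -- distNorm d / (1 - β)`; they add up to `distNorm d / (1 - β)`.
  have h3 : distNorm d / (1 - β) * l1dist p p' =
      distNorm d * l1dist p p' + β * (distNorm d / (1 - β) * l1dist p p') := by
    field_simp; ring
  rw [h3]
  refine (abs_add_le _ _).trans (add_le_add h1 ?_)
  rw [abs_mul, abs_of_pos hβ0]
  exact mul_le_mul_of_nonneg_left h2 hβ0.le

include hd hβ0 hβ1 hV hVb in
-- An arbitrary policy cannot beat `V` by more than the potential: `V` is a subsolution for its cost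
-- up to the one-step error, and `stabilityPotential_step` absorbs these errors. The last summand is
-- the value left beyond the horizon.
lemma windowValue_le_truncatedCost_add (g : WindowState X M Y N → Quantizer X M) (n : ℕ)
    (w : WindowState X M Y N) :
    Finset.univ.inf' Finset.univ_nonempty (V w.2) ≤ truncatedCost T O g d β n w +
      distNorm d / (1 - β) * stabilityPotential T O β ζ w + β ^ n * (distNorm d / (1 - β)) := by
  have hb : 0 < 1 - β := by linarith
  have hC : 0 ≤ distNorm d / (1 - β) := div_nonneg (distNorm_nonneg hd) hb.le
  induction n generalizing w with
  | zero =>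
    have h1 := (inf'_windowValue_mem hVb w.2).2
    have h2 := mul_nonneg hC (stabilityPotential_nonneg T O hβ0 hβ1 ζ w)
    simp only [truncatedCost, Finset.range_zero, Finset.sum_empty, pow_zero]
    linarith
  | succ n ih =>
    have h1 := (abs_le.1 (abs_bellman_sub_windowValue_le T O hd hβ0 hβ1 ζ hV hVb w (g w))).1
    have h2 : Finset.univ.inf' Finset.univ_nonempty (V w.2) ≤ V w.2 (g w) :=
      Finset.inf'_le _ (Finset.mem_univ _)
    have h3 : ∑ y, outputProb O (predictor T O w) (g w) y *
          Finset.univ.inf' Finset.univ_nonempty (V (shiftWindow w.2 y (g w))) ≤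
        ∑ y, outputProb O (predictor T O w) (g w) y *
            truncatedCost T O g d β n (nextState T O w y (g w)) +
          distNorm d / (1 - β) * ∑ y, outputProb O (predictor T O w) (g w) y *
            stabilityPotential T O β ζ (nextState T O w y (g w)) +
          β ^ n * (distNorm d / (1 - β)) := by
      calc _ ≤ ∑ y, outputProb O (predictor T O w) (g w) y *
            (truncatedCost T O g d β n (nextState T O w y (g w)) +
              distNorm d / (1 - β) * stabilityPotential T O β ζ (nextState T O w y (g w)) +
              β ^ n * (distNorm d / (1 - β))) :=
            Finset.sum_le_sum fun y _ => mul_le_mul_of_nonneg_left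
              (ih (nextState T O w y (g w))) (outputProb_nonneg _ _ _ _)
        _ = _ := by
            simp only [mul_add, Finset.sum_add_distrib]
            rw [← Finset.sum_mul, outputProb_sum, one_mul, Finset.mul_sum]
            congr 2
            exact Finset.sum_congr rfl fun y _ => by ring
    have h4 := mul_le_mul_of_nonneg_left h3 hβ0.le
    have h5 := mul_le_mul_of_nonneg_left (stabilityPotential_step T O hβ0 hβ1 ζ w (g w)) hC
    rw [truncatedCost_succ, pow_succ]
    linarith

/-- The predictor is dominated by the unnormalized predictor that starts from `ζ`. -/
def IsDominated (w : WindowState X M Y N) : Prop :=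
  ∃ c : ℝ, ∀ x, predictor T O w x ≤ c * windowMass T O ζ w.2 x

omit [Nonempty X] [DecidableEq X] [Fintype M] [Nonempty M] [DecidableEq Y] in
lemma IsDominated.sum_pos {w : WindowState X M Y N} (h : IsDominated T O ζ w) :
    0 < ∑ x, windowMass T O ζ w.2 x := by
  have h0 : ∀ x, 0 ≤ windowMass T O ζ w.2 x := windowMass_nonneg T O (belief_nonneg ζ) w.2
  refine (Finset.sum_nonneg fun x _ => h0 x).lt_of_ne fun e => ?_
  have hz := (Finset.sum_eq_zero_iff_of_nonneg fun x _ => h0 x).1 e.symm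
  obtain ⟨c, hc⟩ := h
  have : ∑ x, predictor T O w x ≤ 0 := Finset.sum_nonpos fun x hx => by
    have := hc x
    rwa [hz x hx, mul_zero] at this
  rw [belief_sum] at this
  linarith

variable (hζ : ∀ x', ∑ x, T x x' * ζ x = ζ x')

omit [Nonempty X] [DecidableEq X] [Fintype M] [Nonempty M] [DecidableEq Y] in
include hζ in
-- Omitting the likelihood `O (q x) y ≤ 1` leaves the action of the source kernel on `ζ`, which is
-- `ζ` itself.
lemma massStep_invariant_le (y : Y) (q : Quantizer X M) (x : X) :
    massStep T O ζ y q x ≤ ζ x := by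
  rw [← hζ x]
  refine Finset.sum_le_sum fun x' _ => mul_le_mul_of_nonneg_left ?_ (belief_nonneg _ _)
  exact mul_le_of_le_one_left (belief_nonneg _ _) (belief_le_one _ _)

omit [Nonempty X] [DecidableEq X] [Fintype M] [Nonempty M] [DecidableEq Y] in
include hζ in
-- Domination survives the new pair because the mass recursion is monotone and linear, and survives
-- the loss of the oldest pair because restarting from `ζ` one step later can only increase the
-- mass.
lemma IsDominated.nextState {w : WindowState X M Y N} (h : IsDominated T O ζ w) {y : Y}
    {q : Quantizer X M} (hy : 0 < outputProb O (predictor T O w) q y) :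
    IsDominated T O ζ (nextState T O w y q) := by
  obtain ⟨c, hc⟩ := h
  set P := outputProb O (predictor T O w) q y
  have hu : ∀ x, 0 ≤ windowMass T O ζ w.2 x := windowMass_nonneg T O (belief_nonneg ζ) w.2
  refine ⟨P⁻¹ * |c|, fun x => ?_⟩
  have h1 : P * predictor T O (ZeroDelay.nextState T O w y q) x ≤
      |c| * massStep T O (windowMass T O ζ w.2) y q x := by
    rw [predictor_nextState, outputProb_mul_update]
    have := congrFun (massStep_const_mul T O |c| (windowMass T O ζ w.2) y q) x
    rw [← this]
    exact massStep_mono T O (fun x => (hc x).trans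
      (mul_le_mul_of_nonneg_right (le_abs_self c) (hu x))) y q x
  have h2 : massStep T O (windowMass T O ζ w.2) y q x ≤
      windowMass T O ζ (shiftWindow w.2 y q) x := by
    obtain ⟨y₀, q₀, e⟩ := windowMass_shiftWindow T O ζ w.2 y q
    rw [← e]
    exact windowMass_mono T O (massStep_invariant_le T O ζ hζ y₀ q₀) _ x
  have h3 := h1.trans (mul_le_mul_of_nonneg_left h2 (abs_nonneg c))
  rw [mul_assoc, ← div_eq_inv_mul, le_div_iff₀ hy, mul_comm]
  exact h3

include hd hβ0 hβ1 hV hVb hζ in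
-- The converse comparison, for the greedy policy only. Greediness is available only at windows of
-- positive mass, so domination is carried through the induction. No remainder appears, since `V` is
-- nonnegative.
lemma truncatedCost_le_windowValue_add (greedy : Window X M Y N → Quantizer X M)
    (hg : ∀ I, 0 < ∑ x, windowMass T O ζ I x → ∀ q, V I (greedy I) ≤ V I q) (n : ℕ)
    (w : WindowState X M Y N) (hw : IsDominated T O ζ w) :
    truncatedCost T O (fun v => greedy v.2) d β n w ≤
      Finset.univ.inf' Finset.univ_nonempty (V w.2) +
        distNorm d / (1 - β) * stabilityPotential T O β ζ w := by
  have hb : 0 < 1 - β := by linarith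
  have hC : 0 ≤ distNorm d / (1 - β) := div_nonneg (distNorm_nonneg hd) hb.le
  induction n generalizing w with
  | zero =>
    have h1 := (inf'_windowValue_mem hVb w.2).1
    have h2 := mul_nonneg hC (stabilityPotential_nonneg T O hβ0 hβ1 ζ w)
    simp only [truncatedCost, Finset.range_zero, Finset.sum_empty]
    linarith
  | succ n ih =>
    set q := greedy w.2 with hq
    have h1 := (abs_le.1 (abs_bellman_sub_windowValue_le T O hd hβ0 hβ1 ζ hV hVb w q)).2
    have h2 : V w.2 q ≤ Finset.univ.inf' Finset.univ_nonempty (V w.2) :=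
      Finset.le_inf' _ _ fun v _ => hg w.2 (hw.sum_pos) v
    have h3 : ∑ y, outputProb O (predictor T O w) q y *
          truncatedCost T O (fun v => greedy v.2) d β n (nextState T O w y q) ≤
        ∑ y, outputProb O (predictor T O w) q y *
            Finset.univ.inf' Finset.univ_nonempty (V (shiftWindow w.2 y q)) +
          distNorm d / (1 - β) * ∑ y, outputProb O (predictor T O w) q y *
            stabilityPotential T O β ζ (nextState T O w y q) := by
      rw [Finset.mul_sum, ← Finset.sum_add_distrib]
      refine Finset.sum_le_sum fun y _ => ?_
      -- Domination may fail after an output of probability zero, but such an output has no weight.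
      rcases (outputProb_nonneg O (predictor T O w) q y).eq_or_lt with h0 | hpos
      · rw [← h0]; simp
      · have := mul_le_mul_of_nonneg_left (ih (nextState T O w y q) (hw.nextState T O ζ hζ hpos))
          hpos.le
        refine this.trans (le_of_eq ?_)
        have e : (nextState T O w y q).2 = shiftWindow w.2 y q := rfl
        rw [e]; ring
    have h4 := mul_le_mul_of_nonneg_left h3 hβ0.le
    have h5 := mul_le_mul_of_nonneg_left (stabilityPotential_step T O hβ0 hβ1 ζ w q) hC
    rw [truncatedCost_succ]
    simp only [← hq]
    linarith

include hd hβ0 hβ1 hV hVb in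
lemma windowValue_le_optimalCost_add (w : WindowState X M Y N) :
    Finset.univ.inf' Finset.univ_nonempty (V w.2) ≤ optimalCost T O d β w +
      distNorm d / (1 - β) * stabilityPotential T O β ζ w := by
  rw [← sub_le_iff_le_add]
  refine le_ciInf fun g => ?_
  rw [sub_le_iff_le_add]
  have hlim : Tendsto (fun n => discountedCost T O d β w g +
      distNorm d / (1 - β) * stabilityPotential T O β ζ w + β ^ n * (distNorm d / (1 - β))) atTop
      (𝓝 (discountedCost T O d β w g +
        distNorm d / (1 - β) * stabilityPotential T O β ζ w + 0 * (distNorm d / (1 - β)))) :=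
    tendsto_const_nhds.add ((tendsto_pow_atTop_nhds_zero_of_lt_one hβ0.le hβ1).mul_const _)
  rw [zero_mul, add_zero] at hlim
  refine ge_of_tendsto' hlim fun n => ?_
  have h1 := windowValue_le_truncatedCost_add T O hd hβ0 hβ1 ζ hV hVb g n w
  have h2 := truncatedCost_le_discountedCost T O hd g hβ0 hβ1 n w
  linarith

omit [Nonempty X] [DecidableEq X] [Fintype M] [Nonempty M] [DecidableEq Y] in
-- Positivity of `ζ` bounds any prior by a multiple of `ζ`. Running the monotone mass recursion on
-- both sides and dividing by the mass of the window, positive here, gives domination of the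
-- predictor.
lemma isDominated_of_initialProb_pos (hζ0 : ∀ x, 0 < ζ x) (p : Belief X)
    (g : InitialPolicy X M Y N) (I : Window X M Y N) (h : 0 < initialProb T O p g I) :
    IsDominated T O ζ (p, I) := by
  classical
  have htot : 0 < ∑ x, windowMass T O p I x := by
    rw [initialProb_eq] at h
    split_ifs at h
    · exact h
    · exact absurd h (lt_irrefl 0)
  set c := ∑ x, (ζ x)⁻¹ with hc
  have hle : ∀ x, p x ≤ c * ζ x := by
    intro x
    have h1 : (ζ x)⁻¹ ≤ c := Finset.single_le_sum (f := fun x => (ζ x)⁻¹)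
      (fun x _ => (inv_pos.2 (hζ0 x)).le) (Finset.mem_univ x)
    calc p x ≤ 1 := belief_le_one p x
      _ = (ζ x)⁻¹ * ζ x := (inv_mul_cancel₀ (hζ0 x).ne').symm
      _ ≤ c * ζ x := mul_le_mul_of_nonneg_right h1 (hζ0 x).le
  refine ⟨(∑ x, windowMass T O p I x)⁻¹ * c, fun x => ?_⟩
  have h1 := windowMass_mono T O hle I x
  rw [windowMass_const_mul] at h1
  rw [windowMass_eq] at h1
  rw [mul_assoc, ← div_eq_inv_mul, le_div_iff₀ htot, mul_comm]
  exact h1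

include hd hβ0 hβ1 hV hVb hζ in
/-- The loss of a policy that is greedy for the finite model with the frozen belief `ζ`. -/
lemma initialExp_greedy_sub_optimal_le (hζ0 : ∀ x, 0 < ζ x)
    (greedy : Window X M Y N → Quantizer X M)
    (hg : ∀ I, 0 < ∑ x, windowMass T O ζ I x → ∀ q, V I (greedy I) ≤ V I q)
    (p : Belief X) (g : InitialPolicy X M Y N) :
    initialExp T O p g (fun w =>
        discountedCost T O d β w (fun v => greedy v.2) - optimalCost T O d β w) ≤
      4 * distNorm d / (1 - β) ^ 2 * ((1 - dobrushin T) * (2 - dobrushin O)) ^ N := by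
  have hb : 0 < 1 - β := by linarith
  have hC : 0 ≤ distNorm d / (1 - β) := div_nonneg (distNorm_nonneg hd) hb.le
  calc _ ≤ ∑ I, initialProb T O p g I *
        (2 * (distNorm d / (1 - β)) * stabilityPotential T O β ζ (p, I)) := by
        refine Finset.sum_le_sum fun I _ => ?_
        -- At windows of positive probability the two comparisons with the minimum of `V` are added,
        -- which gives the factor 2; the others have no weight.
        rcases (initialProb_nonneg T O p g I).eq_or_lt with h0 | hpos
        · rw [← h0, zero_mul, zero_mul]
        · refine mul_le_mul_of_nonneg_left ?_ hpos.le
          have h1 := windowValue_le_optimalCost_add T O hd hβ0 hβ1 ζ hV hVb (p, I)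
          have h2 := discountedCost_le_of_truncatedCost_le T O hd (fun v => greedy v.2) hβ0 hβ1
            (p, I) fun n => truncatedCost_le_windowValue_add T O hd hβ0 hβ1 ζ hV hVb hζ greedy hg
              n (p, I) (isDominated_of_initialProb_pos T O ζ hζ0 p g I hpos)
          linarith
    _ = 2 * (distNorm d / (1 - β)) * initialExp T O p g (stabilityPotential T O β ζ) := by
        rw [initialExp, Finset.mul_sum]
        exact Finset.sum_congr rfl fun I _ => by ring
    _ ≤ 2 * (distNorm d / (1 - β)) *
        (2 / (1 - β) * ((1 - dobrushin T) * (2 - dobrushin O)) ^ N) :=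
        mul_le_mul_of_nonneg_left (initialExp_stabilityPotential_le T O hβ0 hβ1 ζ p g)
          (mul_nonneg zero_le_two hC)
    _ = _ := by
        field_simp; ring

end Performance

/-! ### Deterministic convergence of Q-learning -/

section QIterate

variable {Z U : Type*} [DecidableEq Z] [DecidableEq U] [Fintype U] [Nonempty U]
  (β : ℝ) (V0 : Z → U → ℝ) (z : ℕ → Z) (u : ℕ → U) (c : ℕ → ℝ)

/-- The number of visits to `(s, a)` before time `t`. -/
def visits (s : Z) (a : U) (t : ℕ) : ℝ :=
  ∑ k ∈ Finset.range t, if z k = s ∧ u k = a then 1 else 0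

omit [Fintype U] [Nonempty U] in
lemma visits_nonneg (s : Z) (a : U) (t : ℕ) : 0 ≤ visits z u s a t :=
  Finset.sum_nonneg fun k _ => by split_ifs <;> norm_num

lemma qIterate_succ (t : ℕ) (s : Z) (a : U) :
    qIterate β V0 z u c (t + 1) s a =
      if s = z t ∧ a = u t then
        (1 - 1 / (1 + visits z u s a (t + 1))) * qIterate β V0 z u c t s a +
          1 / (1 + visits z u s a (t + 1)) * (c t + β * Finset.univ.inf' Finset.univ_nonempty
            (qIterate β V0 z u c t (z (t + 1))))
      else qIterate β V0 z u c t s a := rfl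

lemma qIterate_eq_of_forall_ne {s : Z} (h : ∀ t, z t ≠ s) (t : ℕ) (a : U) :
    qIterate β V0 z u c t s a = V0 s a := by
  induction t with
  | zero => rfl
  | succ t ih => rw [qIterate_succ, if_neg fun e => h t e.1.symm, ih]

/-- The iterate is an average of the initial value and of the samples. -/
lemma one_add_visits_mul_qIterate (s : Z) (a : U) (t : ℕ) :
    (1 + visits z u s a t) * qIterate β V0 z u c t s a =
      V0 s a + ∑ k ∈ Finset.range t, if z k = s ∧ u k = a then
        c k + β * Finset.univ.inf' Finset.univ_nonempty (qIterate β V0 z u c k (z (k + 1)))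
      else 0 := by
  induction t with
  | zero => simp [visits, qIterate]
  | succ t ih =>
    rw [Finset.sum_range_succ, ← add_assoc, ← ih, qIterate_succ]
    have hn := visits_nonneg z u s a t
    have e : visits z u s a (t + 1) = visits z u s a t + if z t = s ∧ u t = a then 1 else 0 :=
      Finset.sum_range_succ _ _
    by_cases h : z t = s ∧ u t = a
    -- At a visit the step size is `1 / (n + 2)`, where `n` counts the earlier visits. Thus `V0`
    -- counts as one sample and all samples have equal weight.
    · rw [if_pos ⟨h.1.symm, h.2.symm⟩, if_pos h, e, if_pos h]
      have : 1 + (visits z u s a t + 1) ≠ 0 := by positivity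
      field_simp
      ring
    · rw [if_neg fun h' => h ⟨h'.1.symm, h'.2.symm⟩, if_neg h, e, if_neg h]
      ring

lemma abs_qIterate_le (hβ0 : 0 < β) {K : ℝ} (hV0 : ∀ s a, |V0 s a| ≤ K)
    (hc : ∀ t, |c t| ≤ (1 - β) * K) (t : ℕ) (s : Z) (a : U) :
    |qIterate β V0 z u c t s a| ≤ K := by
  induction t generalizing s a with
  | zero => exact hV0 s a
  | succ t ih =>
    rw [qIterate_succ]
    split_ifs with h
    · set α := 1 / (1 + visits z u s a (t + 1))
      have hn := visits_nonneg z u s a (t + 1)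
      have hα0 : 0 ≤ α := by positivity
      have hα1 : α ≤ 1 := by
        rw [div_le_one (by positivity)]; linarith
      have h1 : |Finset.univ.inf' Finset.univ_nonempty
          (qIterate β V0 z u c t (z (t + 1)))| ≤ K := by
        obtain ⟨v, _, e⟩ := Finset.exists_mem_eq_inf' (Finset.univ_nonempty (α := U))
          (qIterate β V0 z u c t (z (t + 1)))
        rw [e]
        exact ih _ _
      have h2 : |c t + β * Finset.univ.inf' Finset.univ_nonempty
          (qIterate β V0 z u c t (z (t + 1)))| ≤ K := by
        refine (abs_add_le _ _).trans ?_
        rw [abs_mul, abs_of_pos hβ0]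
        have := hc t
        have := mul_le_mul_of_nonneg_left h1 hβ0.le
        linarith
      refine (abs_add_le _ _).trans ?_
      rw [abs_mul, abs_mul, abs_of_nonneg hα0, abs_of_nonneg (sub_nonneg.2 hα1)]
      have h3 := mul_le_mul_of_nonneg_left h2 hα0
      have h4 := mul_le_mul_of_nonneg_left (ih s a) (sub_nonneg.2 hα1)
      linarith
    · exact ih s a

variable {β V0 z u c} {V : Z → U → ℝ} {G : Z → Prop} {cost m : Z → U → ℝ}

/-- An eventual error bound `L` improves to `β * L + ε`. -/
lemma eventually_abs_qIterate_sub_le (hβ0 : 0 < β)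
    (hG : ∀ t, G (z t)) (hc : ∀ t, c t = cost (z t) (u t)) {s : Z} {a : U}
    (hV : V s a = cost s a + β * m s a)
    (hvis : Tendsto (visits z u s a) atTop atTop)
    (havg : Tendsto (fun t => (∑ k ∈ Finset.range t, if z k = s ∧ u k = a then
        Finset.univ.inf' Finset.univ_nonempty (V (z (k + 1))) else 0) / visits z u s a t) atTop
      (𝓝 (m s a)))
    {K : ℝ} (hK : ∀ t s a, |qIterate β V0 z u c t s a - V s a| ≤ K) {L : ℝ} (hL0 : 0 ≤ L)
    (hL : ∀ᶠ t in atTop, ∀ s, G s → ∀ a, |qIterate β V0 z u c t s a - V s a| ≤ L)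
    {ε : ℝ} (hε : 0 < ε) :
    ∀ᶠ t in atTop, |qIterate β V0 z u c t s a - V s a| ≤ β * L + ε := by
  obtain ⟨t₀, ht₀⟩ := eventually_atTop.1 hL
  set A : ℕ → ℝ := fun t => ∑ k ∈ Finset.range t, if z k = s ∧ u k = a then
        Finset.univ.inf' Finset.univ_nonempty (V (z (k + 1))) else 0 with hA
  set n := visits z u s a with hn
  have hn0 : ∀ t, 0 ≤ n t := visits_nonneg z u s a
  have hK0 : 0 ≤ K := (abs_nonneg _).trans (hK 0 s a)
  -- The contribution that does not grow with the number of visits: the initial error, and the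
  -- samples before `t₀`, where only the crude bound `K` holds.
  set R := |V0 s a - V s a| + β * (K * t₀) with hR
  have key : ∀ t, (1 + n t) * |qIterate β V0 z u c t s a - V s a| ≤
      R + β * |A t - n t * m s a| + β * (L * n t) := by
    intro t
    set B : ℕ → ℝ := fun k => Finset.univ.inf' Finset.univ_nonempty
        (qIterate β V0 z u c k (z (k + 1))) -
      Finset.univ.inf' Finset.univ_nonempty (V (z (k + 1))) with hB
    -- The error splits into the initial error, the deviation of the empirical average of `V` at the
    -- next states from its limit, and the averaged error of the iterates themselves, which carries
    -- the factor `β`.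
    have e1 : (1 + n t) * (qIterate β V0 z u c t s a - V s a) =
        (V0 s a - V s a) + β * (A t - n t * m s a) +
          β * ∑ k ∈ Finset.range t, if z k = s ∧ u k = a then B k else 0 := by
      rw [mul_sub, one_add_visits_mul_qIterate]
      have e2 : (∑ k ∈ Finset.range t, if z k = s ∧ u k = a then
          c k + β * Finset.univ.inf' Finset.univ_nonempty (qIterate β V0 z u c k (z (k + 1)))
          else 0) = n t * cost s a + β * A t +
            β * ∑ k ∈ Finset.range t, if z k = s ∧ u k = a then B k else 0 := by
        rw [hn, visits, hA, Finset.sum_mul, Finset.mul_sum, Finset.mul_sum,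
          ← Finset.sum_add_distrib, ← Finset.sum_add_distrib]
        refine Finset.sum_congr rfl fun k _ => ?_
        split_ifs with h
        · rw [hc k, h.1, h.2, hB]; ring
        · ring
      rw [e2, hV]; ring
    have e3 : |∑ k ∈ Finset.range t, if z k = s ∧ u k = a then B k else 0| ≤
        K * t₀ + L * n t := by
      have hb : ∀ k ∈ Finset.range t, |if z k = s ∧ u k = a then B k else 0| ≤
          (if k < t₀ then K else 0) + L * if z k = s ∧ u k = a then 1 else 0 := by
        intro k _
        split_ifs with h hk hk
        · have : |B k| ≤ K := abs_inf'_sub_inf'_le fun v => hK k _ v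
          linarith
        · have : |B k| ≤ L := abs_inf'_sub_inf'_le fun v => ht₀ k (not_lt.1 hk) _ (hG _) v
          linarith
        · simpa using hK0
        · simp
      refine (Finset.abs_sum_le_sum_abs _ _).trans ((Finset.sum_le_sum hb).trans ?_)
      rw [Finset.sum_add_distrib, ← Finset.mul_sum]
      refine add_le_add ?_ le_rfl
      rw [← Finset.sum_filter, Finset.sum_const, nsmul_eq_mul, mul_comm]
      refine mul_le_mul_of_nonneg_left ?_ hK0
      have hsub : (Finset.range t).filter (fun k => k < t₀) ⊆ Finset.range t₀ := fun k hk =>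
        Finset.mem_range.2 (Finset.mem_filter.1 hk).2
      exact_mod_cast (Finset.card_le_card hsub).trans (Finset.card_range t₀).le
    have e4 : (1 + n t) * |qIterate β V0 z u c t s a - V s a| =
        |(1 + n t) * (qIterate β V0 z u c t s a - V s a)| := by
      rw [abs_mul, abs_of_nonneg (by linarith [hn0 t] : 0 ≤ 1 + n t)]
    rw [e4, e1]
    refine (abs_add_le _ _).trans ((add_le_add (abs_add_le _ _) le_rfl).trans ?_)
    rw [abs_mul, abs_mul, abs_of_pos hβ0]
    have := mul_le_mul_of_nonneg_left e3 hβ0.le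
    rw [hR]
    linarith
  have hlim : Tendsto (fun t => R / n t + β * |A t / n t - m s a| + β * L) atTop
      (𝓝 (0 + β * |m s a - m s a| + β * L)) :=
    ((hvis.const_div_atTop R).add (((havg.sub_const _).abs).const_mul β)).add_const _
  have hlt : 0 + β * |m s a - m s a| + β * L < β * L + ε := by simp [hε]
  filter_upwards [hlim.eventually_lt_const hlt, hvis.eventually_gt_atTop 0] with t h1 h2
  refine le_trans ?_ h1.le
  have h3 := key t
  have hR0 : 0 ≤ R := by positivity
  have h5 : |qIterate β V0 z u c t s a - V s a| * n t ≤
      R + β * |A t - n t * m s a| + β * (L * n t) := by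
    have := abs_nonneg (qIterate β V0 z u c t s a - V s a)
    nlinarith
  have h6 : |A t - n t * m s a| = |A t / n t - m s a| * n t := by
    have : A t - n t * m s a = (A t / n t - m s a) * n t := by field_simp
    rw [this, abs_mul, abs_of_pos h2]
  refine (le_div_iff₀ h2).2 h5 |>.trans (le_of_eq ?_)
  rw [h6]
  field_simp

/-- Q-learning converges along every sequence of states and actions whose empirical averages
converge. -/
lemma tendsto_qIterate [Finite Z] (hβ0 : 0 < β) (hβ1 : β < 1)
    (hG : ∀ t, G (z t)) (hc : ∀ t, c t = cost (z t) (u t))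
    (hV : ∀ s, G s → ∀ a, V s a = cost s a + β * m s a)
    (hvis : ∀ s, G s → ∀ a, Tendsto (visits z u s a) atTop atTop)
    (havg : ∀ s, G s → ∀ a, Tendsto (fun t => (∑ k ∈ Finset.range t, if z k = s ∧ u k = a then
        Finset.univ.inf' Finset.univ_nonempty (V (z (k + 1))) else 0) / visits z u s a t) atTop
      (𝓝 (m s a)))
    {s : Z} (hs : G s) (a : U) :
    Tendsto (fun t => qIterate β V0 z u c t s a) atTop (𝓝 (V s a)) := by
  have hb : 0 < 1 - β := by linarith
  obtain ⟨K₁, hK₁⟩ := (Set.finite_range fun p : Z × U => |V0 p.1 p.2|).bddAbove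
  obtain ⟨K₂, hK₂⟩ := (Set.finite_range fun p : Z × U => |cost p.1 p.2|).bddAbove
  obtain ⟨K₃, hK₃⟩ := (Set.finite_range fun p : Z × U => |V p.1 p.2|).bddAbove
  set K' := max K₁ (K₂ / (1 - β)) with hK'
  have hq : ∀ t s a, |qIterate β V0 z u c t s a| ≤ K' := by
    refine abs_qIterate_le β V0 z u c hβ0 (fun s a => ?_) fun t => ?_
    · exact (hK₁ ⟨(s, a), rfl⟩).trans (le_max_left _ _)
    · have h1 : |cost (z t) (u t)| ≤ K₂ := hK₂ ⟨(z t, u t), rfl⟩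
      have h2 : K₂ / (1 - β) ≤ K' := le_max_right _ _
      rw [div_le_iff₀ hb] at h2
      rw [hc]
      linarith
  set K := K' + K₃ with hKdef
  have hK : ∀ t s a, |qIterate β V0 z u c t s a - V s a| ≤ K := fun t s a =>
    (abs_sub _ _).trans (add_le_add (hq t s a) (hK₃ ⟨(s, a), rfl⟩))
  have hK0 : 0 ≤ K := (abs_nonneg _).trans (hK 0 s a)
  -- Choosing `ε = (1 - β) / 2 * L` turns `β * L + ε` into `(1 + β) / 2 * L`. Starting from `K + 1`
  -- rather than `K` keeps `L`, hence `ε`, positive.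
  have hev : ∀ j : ℕ, ∀ᶠ t in atTop, ∀ s, G s → ∀ a,
      |qIterate β V0 z u c t s a - V s a| ≤ (K + 1) * ((1 + β) / 2) ^ j := by
    intro j
    induction j with
    | zero =>
      refine Eventually.of_forall fun t s _ a => ?_
      rw [pow_zero, mul_one]
      linarith [hK t s a]
    | succ j ih =>
      have hLpos : 0 < (K + 1) * ((1 + β) / 2) ^ j := by positivity
      rw [eventually_all]
      intro s
      by_cases hs : G s
      · refine Eventually.mono (eventually_all.2 fun a =>
          eventually_abs_qIterate_sub_le hβ0 hG hc (hV s hs a) (hvis s hs a) (havg s hs a) hK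
            hLpos.le ih (ε := (1 - β) / 2 * ((K + 1) * ((1 + β) / 2) ^ j)) (by positivity))
          fun t h _ a => (h a).trans (le_of_eq ?_)
        rw [pow_succ]; ring
      · exact Eventually.of_forall fun t h => absurd h hs
  have hpow : Tendsto (fun j : ℕ => (K + 1) * ((1 + β) / 2) ^ j) atTop (𝓝 ((K + 1) * 0)) :=
    (tendsto_pow_atTop_nhds_zero_of_lt_one (by linarith) (by linarith)).const_mul _
  rw [mul_zero] at hpow
  rw [Metric.tendsto_atTop']
  intro ε hε
  obtain ⟨j, hj⟩ := (hpow.eventually_lt_const hε).exists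
  obtain ⟨t₀, ht₀⟩ := eventually_atTop.1 (hev j)
  exact ⟨t₀, fun t ht => by
    rw [Real.dist_eq]; exact (ht₀ t (le_of_lt ht) s hs a).trans_lt hj⟩

end QIterate

/-! ### A strong law for bounded orthogonal variables -/

section Orthogonal

variable {Ω : Type*} [MeasurableSpace Ω] {ℙ : Measure Ω} [IsProbabilityMeasure ℙ]
  {D : ℕ → Ω → ℝ} {C : ℝ}

lemma integrable_of_abs_le {f : Ω → ℝ} (hf : Measurable f) (hb : ∀ ω, |f ω| ≤ C) :
    Integrable f ℙ :=
  Integrable.of_bound hf.aestronglyMeasurable C (Eventually.of_forall hb)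

omit [MeasurableSpace Ω] in
lemma abs_sum_range_le (hb : ∀ t ω, |D t ω| ≤ C) (n : ℕ) (ω : Ω) :
    |∑ t ∈ Finset.range n, D t ω| ≤ n * C := by
  refine (Finset.abs_sum_le_sum_abs _ _).trans ((Finset.sum_le_sum fun t _ => hb t ω).trans ?_)
  simp

lemma integral_sq_sum_le (hD : ∀ t, Measurable (D t)) (hb : ∀ t ω, |D t ω| ≤ C)
    (ho : ∀ s t, s < t → ∫ ω, D s ω * D t ω ∂ℙ = 0) (n : ℕ) :
    ∫ ω, (∑ t ∈ Finset.range n, D t ω) ^ 2 ∂ℙ ≤ n * C ^ 2 := by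
  have hSm : ∀ n, Measurable fun ω => ∑ t ∈ Finset.range n, D t ω := fun n =>
    Finset.measurable_sum _ fun t _ => hD t
  induction n with
  | zero => simp
  | succ n ih =>
    have e : ∀ ω, (∑ t ∈ Finset.range (n + 1), D t ω) ^ 2 =
        (∑ t ∈ Finset.range n, D t ω) ^ 2 + 2 * (∑ t ∈ Finset.range n, D t ω * D n ω) +
          D n ω ^ 2 := by
      intro ω
      rw [Finset.sum_range_succ, ← Finset.sum_mul]; ring
    have i1 : Integrable (fun ω => (∑ t ∈ Finset.range n, D t ω) ^ 2) ℙ :=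
      integrable_of_abs_le (C := (n * C) ^ 2) ((hSm n).pow_const 2) fun ω => by
        rw [abs_pow]
        exact pow_le_pow_left₀ (abs_nonneg _) (abs_sum_range_le hb n ω) 2
    have i2 : ∀ t, Integrable (fun ω => D t ω * D n ω) ℙ := fun t =>
      integrable_of_abs_le (C := C * C) ((hD t).mul (hD n)) fun ω => by
        rw [abs_mul]
        exact mul_le_mul (hb t ω) (hb n ω) (abs_nonneg _) ((abs_nonneg _).trans (hb t ω))
    have i2' : Integrable (fun ω => 2 * ∑ t ∈ Finset.range n, D t ω * D n ω) ℙ :=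
      (integrable_finsetSum _ fun t _ => i2 t).const_mul 2
    have hsq : ∀ ω, |D n ω ^ 2| ≤ C ^ 2 := fun ω => by
      rw [abs_pow]; exact pow_le_pow_left₀ (abs_nonneg _) (hb n ω) 2
    have i3 : Integrable (fun ω => D n ω ^ 2) ℙ := integrable_of_abs_le ((hD n).pow_const 2) hsq
    have z : ∫ ω, 2 * ∑ t ∈ Finset.range n, D t ω * D n ω ∂ℙ = 0 := by
      rw [integral_const_mul, integral_finsetSum _ fun t _ => i2 t,
        Finset.sum_eq_zero fun t ht => ho t n (Finset.mem_range.1 ht), mul_zero]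
    have h3 : ∫ ω, D n ω ^ 2 ∂ℙ ≤ C ^ 2 := by
      have := integral_mono i3 (integrable_const (C ^ 2)) fun ω => (le_abs_self _).trans (hsq ω)
      simpa using this
    have i12 : Integrable (fun ω => (∑ t ∈ Finset.range n, D t ω) ^ 2 +
        2 * ∑ t ∈ Finset.range n, D t ω * D n ω) ℙ := i1.add i2'
    simp_rw [e]
    rw [integral_add i12 i3, integral_add i1 i2', z]
    push_cast
    linarith

/-- The strong law of large numbers for bounded orthogonal random variables. -/
lemma ae_tendsto_average_of_orthogonal (hD : ∀ t, Measurable (D t)) (hb : ∀ t ω, |D t ω| ≤ C)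
    (ho : ∀ s t, s < t → ∫ ω, D s ω * D t ω ∂ℙ = 0) :
    ∀ᵐ ω ∂ℙ, Tendsto (fun n : ℕ => (∑ t ∈ Finset.range n, D t ω) / n) atTop (𝓝 0) := by
  have hSm : ∀ n, Measurable fun ω => ∑ t ∈ Finset.range n, D t ω := fun n =>
    Finset.measurable_sum _ fun t _ => hD t
  -- Along the squares the second moments of the averages are at most `C ^ 2 / k ^ 2`, hence
  -- summable, and almost surely the squared averages themselves are summable.
  set a : ℕ → Ω → ℝ := fun k ω => ((∑ t ∈ Finset.range (k ^ 2), D t ω) / (k ^ 2 : ℕ)) ^ 2 with ha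
  have ham : ∀ k, Measurable (a k) := fun k => ((hSm _).div_const _).pow_const 2
  have hai : ∀ k, ∫ ω, a k ω ∂ℙ ≤ C ^ 2 * (1 / (k : ℝ) ^ 2) := by
    intro k
    have h1 := integral_sq_sum_le hD hb ho (k ^ 2)
    have e : ∀ ω, a k ω = (((k ^ 2 : ℕ) : ℝ) ^ 2)⁻¹ * (∑ t ∈ Finset.range (k ^ 2), D t ω) ^ 2 :=
      fun ω => by rw [ha]; simp only [div_pow]; rw [div_eq_inv_mul]
    simp_rw [e]
    rw [integral_const_mul]
    refine (mul_le_mul_of_nonneg_left h1 (by positivity)).trans (le_of_eq ?_)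
    rcases Nat.eq_zero_or_pos k with rfl | hk
    · simp
    · push_cast
      field_simp
  have hint : ∀ k, Integrable (a k) ℙ := fun k => by
    refine integrable_of_abs_le (C := C ^ 2) (ham k) fun ω => ?_
    rw [ha]
    simp only [abs_pow, abs_div, Nat.abs_cast]
    refine pow_le_pow_left₀ (by positivity) ?_ 2
    rcases Nat.eq_zero_or_pos k with rfl | hk
    · simpa using (abs_nonneg _).trans (hb 0 ω)
    · rw [div_le_iff₀ (by positivity), mul_comm]
      exact abs_sum_range_le hb _ ω
  have hsum : ∑' k, ∫⁻ ω, ENNReal.ofReal (a k ω) ∂ℙ ≠ ⊤ := by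
    have hs : Summable fun k : ℕ => C ^ 2 * (1 / (k : ℝ) ^ 2) :=
      (Real.summable_one_div_nat_pow.2 one_lt_two).mul_left _
    refine ne_top_of_le_ne_top hs.tsum_ofReal_ne_top (ENNReal.tsum_le_tsum fun k => ?_)
    rw [← ofReal_integral_eq_lintegral_ofReal (hint k)
      (Eventually.of_forall fun ω => sq_nonneg _)]
    exact ENNReal.ofReal_le_ofReal (hai k)
  rw [← lintegral_tsum fun k => (ham k).ennreal_ofReal.aemeasurable] at hsum
  have hfin := ae_lt_top (Measurable.tsum fun k => (ham k).ennreal_ofReal) hsum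
  filter_upwards [hfin] with ω hω
  have h1 : Tendsto (fun k => a k ω) atTop (𝓝 0) := by
    have := ENNReal.tendsto_atTop_zero_of_tsum_ne_top hω.ne
    have h2 := (ENNReal.tendsto_toReal ENNReal.zero_ne_top).comp this
    simpa [Function.comp_def, ENNReal.toReal_ofReal, ha, sq_nonneg] using h2
  have h2 : Tendsto (fun k : ℕ => |∑ t ∈ Finset.range (k ^ 2), D t ω| / (k ^ 2 : ℕ)) atTop
      (𝓝 0) := by
    have := (Real.continuous_sqrt.tendsto 0).comp h1
    simpa [Function.comp_def, ha, Real.sqrt_sq_eq_abs, abs_div] using this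
  have hsqrt : Tendsto Nat.sqrt atTop atTop :=
    tendsto_atTop.2 fun b => (eventually_ge_atTop (b * b)).mono fun n hn => Nat.le_sqrt.2 hn
  have h3 : Tendsto (fun k : ℕ => |∑ t ∈ Finset.range (k ^ 2), D t ω| / (k ^ 2 : ℕ) +
      2 * C / k) atTop (𝓝 (0 + 0)) :=
    h2.add (tendsto_const_nhds.div_atTop tendsto_natCast_atTop_atTop)
  rw [add_zero] at h3
  refine squeeze_zero_norm' ?_ (h3.comp hsqrt)
  filter_upwards [eventually_ge_atTop 1] with n hn
  have hC : 0 ≤ C := (abs_nonneg _).trans (hb 0 ω)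
  -- Between consecutive squares at most `2 * k` bounded terms are added, which is negligible
  -- against `k ^ 2`.
  set k := Nat.sqrt n with hk
  have hk1 : 1 ≤ k := Nat.le_sqrt.2 (by simpa using hn)
  have hk2 : k ^ 2 ≤ n := Nat.sqrt_le' n
  have hk3 : n ≤ k ^ 2 + 2 * k := by
    have := Nat.lt_succ_sqrt' n
    rw [Nat.succ_eq_add_one, ← hk] at this
    nlinarith
  have hdiff : |∑ t ∈ Finset.range n, D t ω| ≤
      |∑ t ∈ Finset.range (k ^ 2), D t ω| + 2 * k * C := by
    rw [← Finset.sum_range_add_sum_Ico _ hk2]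
    refine (abs_add_le _ _).trans (add_le_add le_rfl ?_)
    refine (Finset.abs_sum_le_sum_abs _ _).trans ((Finset.sum_le_sum fun t _ => hb t ω).trans ?_)
    rw [Finset.sum_const, Nat.card_Ico, nsmul_eq_mul]
    refine mul_le_mul_of_nonneg_right ?_ hC
    have : n - k ^ 2 ≤ 2 * k := by omega
    exact_mod_cast this
  have hkpos : (0 : ℝ) < k := by exact_mod_cast hk1
  have hkn : ((k ^ 2 : ℕ) : ℝ) ≤ n := by exact_mod_cast hk2
  have hkk : (0 : ℝ) < ((k ^ 2 : ℕ) : ℝ) := by positivity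
  rw [Real.norm_eq_abs, abs_div, Nat.abs_cast]
  calc |∑ t ∈ Finset.range n, D t ω| / n
      ≤ (|∑ t ∈ Finset.range (k ^ 2), D t ω| + 2 * k * C) / (k ^ 2 : ℕ) :=
        div_le_div₀ (by positivity) hdiff hkk hkn
    _ = |∑ t ∈ Finset.range (k ^ 2), D t ω| / (k ^ 2 : ℕ) + 2 * C / k := by
        rw [add_div]
        congr 1
        push_cast
        field_simp

end Orthogonal

/-! ### Invariant law, harmonic functions and the Poisson equation -/

section Poisson

variable {X : Type*} [Fintype X] [DecidableEq X] {T : X → Belief X}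
  (hT : (Matrix.of fun x x' => T x x').IsIrreducible)

include hT in
lemma exists_pow_pos (x x' : X) : ∃ k : ℕ, 0 < ((Matrix.of fun x x' => T x x') ^ k) x x' := by
  obtain ⟨k, _, hk⟩ := (Matrix.isIrreducible_iff_exists_pow_pos
    (fun i j => belief_nonneg (T i) j)).1 hT x x'
  exact ⟨k, hk⟩

lemma pow_apply_nonneg (k : ℕ) (x x' : X) :
    0 ≤ ((Matrix.of fun x x' => T x x') ^ k) x x' := by
  induction k generalizing x' with
  | zero => rw [pow_zero, Matrix.one_apply]; split_ifs <;> norm_num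
  | succ k ih =>
    rw [pow_succ, Matrix.mul_apply]
    exact Finset.sum_nonneg fun i _ => mul_nonneg (ih i) (belief_nonneg (T i) x')

lemma pow_mulVec_eq {g : X → ℝ} (hg : ∀ x, ∑ x', T x x' * g x' = g x) (k : ℕ) (x : X) :
    ∑ x', ((Matrix.of fun x x' => T x x') ^ k) x x' * g x' = g x := by
  have h : ∀ k : ℕ, ((Matrix.of fun x x' => T x x') ^ k).mulVec g = g := by
    intro k
    induction k with
    | zero => rw [pow_zero, Matrix.one_mulVec]
    | succ k ih =>
      rw [pow_succ, ← Matrix.mulVec_mulVec]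
      have : (Matrix.of fun x x' => T x x').mulVec g = g := funext hg
      rw [this, ih]
  exact congrFun (h k) x

lemma vecMul_pow_eq {ζ : X → ℝ} (hζ : ∀ x', ∑ x, T x x' * ζ x = ζ x') (k : ℕ) (x' : X) :
    ∑ x, ζ x * ((Matrix.of fun x x' => T x x') ^ k) x x' = ζ x' := by
  have h : ∀ k : ℕ, Matrix.vecMul ζ ((Matrix.of fun x x' => T x x') ^ k) = ζ := by
    intro k
    induction k with
    | zero => rw [pow_zero, Matrix.vecMul_one]
    | succ k ih =>
      rw [pow_succ, ← Matrix.vecMul_vecMul, ih]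
      funext x'
      rw [← hζ x']
      exact Finset.sum_congr rfl fun x _ => mul_comm _ _
  exact congrFun (h k) x'

include hT in
lemma invariant_pos {ζ : Belief X} (hζ : ∀ x', ∑ x, T x x' * ζ x = ζ x') (x' : X) : 0 < ζ x' := by
  obtain ⟨x, hx⟩ : ∃ x, 0 < ζ x := by
    by_contra! h
    have := Finset.sum_nonpos fun x (_ : x ∈ Finset.univ) => h x
    rw [belief_sum] at this
    linarith
  obtain ⟨k, hk⟩ := exists_pow_pos hT x x'
  rw [← vecMul_pow_eq hζ k x']
  exact (mul_pos hx hk).trans_le (Finset.single_le_sum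
    (f := fun x => ζ x * ((Matrix.of fun x x' => T x x') ^ k) x x')
    (fun i _ => mul_nonneg (belief_nonneg ζ i) (pow_apply_nonneg k i x')) (Finset.mem_univ x))

include hT in
/-- Harmonic functions of an irreducible kernel are constant. -/
lemma eq_of_harmonic [Nonempty X] {g : X → ℝ} (hg : ∀ x, ∑ x', T x x' * g x' = g x) :
    ∃ c, ∀ x, g x = c := by
  obtain ⟨x₀, h₀⟩ := Finite.exists_max g
  refine ⟨g x₀, fun x => ?_⟩
  -- The maximum principle: the value at a maximum point is an average with respect to a power of
  -- `T` that charges `x`, so `x` attains the maximum too.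
  obtain ⟨k, hk⟩ := exists_pow_pos hT x₀ x
  have h1 := pow_mulVec_eq hg k x₀
  have h2 := pow_mulVec_eq (T := T) (g := fun _ => 1) (fun x => by simp) k x₀
  simp only [mul_one] at h2
  have h3 : ∑ x', ((Matrix.of fun x x' => T x x') ^ k) x₀ x' * (g x₀ - g x') = 0 := by
    simp only [mul_sub, Finset.sum_sub_distrib]
    rw [← Finset.sum_mul, h2, h1]; ring
  have h4 := (Finset.sum_eq_zero_iff_of_nonneg fun x' _ =>
    mul_nonneg (pow_apply_nonneg k x₀ x') (sub_nonneg.2 (h₀ x'))).1 h3 x (Finset.mem_univ x)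
  have h5 := (mul_eq_zero.1 h4).resolve_left hk.ne'
  linarith

include hT in
/-- The Poisson equation of an irreducible kernel. -/
lemma exists_poisson [Nonempty X] {ζ : Belief X} (hζ : ∀ x', ∑ x, T x x' * ζ x = ζ x')
    (h : X → ℝ) : ∃ g : X → ℝ, ∀ x, g x - ∑ x', T x x' * g x' = h x - ∑ x', ζ x' * h x' := by
  let L : (X → ℝ) →ₗ[ℝ] (X → ℝ) := LinearMap.id - (Matrix.of fun x x' => T x x').mulVecLin
  let φ : (X → ℝ) →ₗ[ℝ] ℝ := ∑ x, ζ x • LinearMap.proj x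
  have hL : ∀ g x, L g x = g x - ∑ x', T x x' * g x' := fun g x => rfl
  have hφ : ∀ g, φ g = ∑ x, ζ x * g x := fun g => by simp [φ]
  have hker : LinearMap.ker L ≤ Submodule.span ℝ {fun _ => (1 : ℝ)} := by
    intro g hg
    obtain ⟨c, hc⟩ := eq_of_harmonic hT (g := g) fun x => by
      have := congrFun (LinearMap.mem_ker.1 hg) x
      rw [hL, Pi.zero_apply] at this
      linarith
    exact Submodule.mem_span_singleton.2 ⟨c, funext fun x => by simp [hc x]⟩
  have hker1 : Module.finrank ℝ (LinearMap.ker L) ≤ 1 :=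
    (Submodule.finrank_mono hker).trans ((finrank_span_le_card _).trans (by simp))
  have hle : LinearMap.range L ≤ LinearMap.ker φ := by
    rintro _ ⟨g, rfl⟩
    rw [LinearMap.mem_ker, hφ]
    simp only [hL, mul_sub, Finset.sum_sub_distrib, Finset.mul_sum]
    rw [Finset.sum_comm, ← Finset.sum_sub_distrib]
    refine Finset.sum_eq_zero fun x _ => ?_
    have : ∑ i, ζ i * (T i x * g x) = (∑ i, T i x * ζ i) * g x := by
      rw [Finset.sum_mul]
      exact Finset.sum_congr rfl fun i _ => by ring
    rw [this, hζ, sub_self]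
  have hφ1 : φ (fun _ => 1) = 1 := by simp [hφ]
  have hrange : LinearMap.range φ = ⊤ := by
    rw [LinearMap.range_eq_top]
    intro c
    exact ⟨c • fun _ => 1, by rw [map_smul, hφ1, smul_eq_mul, mul_one]⟩
  have h1 := LinearMap.finrank_range_add_finrank_ker L
  have h2 := LinearMap.finrank_range_add_finrank_ker φ
  rw [hrange, finrank_top, Module.finrank_self] at h2
  -- Invariance puts the range of `L` inside the hyperplane of functions of `ζ`-mean zero. As the
  -- kernel of `L` has dimension at most one, the dimensions force equality.
  have heq := Submodule.eq_of_le_of_finrank_le hle (by omega)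
  have hmem : (fun x => h x - ∑ x', ζ x' * h x') ∈ LinearMap.ker φ := by
    rw [LinearMap.mem_ker, hφ]
    simp only [mul_sub, Finset.sum_sub_distrib]
    rw [← Finset.sum_mul, belief_sum, one_mul, sub_self]
  rw [← heq] at hmem
  obtain ⟨g, hg⟩ := hmem
  exact ⟨g, fun x => by rw [← hL, hg]⟩

end Poisson

/-! ### The exploration process as a Markov chain and its martingale differences -/

section Markov

variable {X M Y : Type*} [Fintype X] [DecidableEq X] [Fintype M] [Fintype Y]

/-- A source symbol, a quantizer and a channel output. -/
abbrev Sample (X M Y : Type*) := X × Quantizer X M × Y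

/-- The path of the exploration process. -/
def samplePath {Ω : Type*} (src : ℕ → Ω → X) (qnt : ℕ → Ω → Quantizer X M) (out : ℕ → Ω → Y)
    (ω : Ω) : ℕ → Sample X M Y :=
  fun i => (src i ω, qnt i ω, out i ω)

/-- The transition probabilities of the exploration process. -/
def transition (T : X → Belief X) (O : M → Belief Y) (s s' : Sample X M Y) : ℝ :=
  T s.1 s'.1 * (1 / (Fintype.card (Quantizer X M) : ℝ) * O (s'.2.1 s'.1) s'.2.2)

/-- The transition operator of the exploration process. -/
def transitionExp (T : X → Belief X) (O : M → Belief Y) (f : Sample X M Y → ℝ)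
    (s : Sample X M Y) : ℝ :=
  ∑ s', transition T O s s' * f s'

/-- The path that follows `σ` up to time `n` and then stays constant. -/
def extendPath {S : Type*} {n : ℕ} (σ : Fin (n + 1) → S) : ℕ → S :=
  fun i => σ ⟨min i n, by omega⟩

variable {Ω : Type*} [MeasurableSpace Ω] {ℙ : Measure Ω} [IsProbabilityMeasure ℙ]
  {T : X → Belief X} {O : M → Belief Y} {p0 : Belief X}
  {src : ℕ → Ω → X} {qnt : ℕ → Ω → Quantizer X M} {out : ℕ → Ω → Y}
  (hexp : IsExploration ℙ T O p0 src qnt out)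

omit [IsProbabilityMeasure ℙ] in
include hexp in
lemma measurableSet_samplePath_eq (i : ℕ) (s : Sample X M Y) :
    MeasurableSet {ω | samplePath src qnt out ω i = s} := by
  have e : {ω | samplePath src qnt out ω i = s} =
      {ω | src i ω = s.1} ∩ ({ω | qnt i ω = s.2.1} ∩ {ω | out i ω = s.2.2}) := by
    ext ω
    simp [samplePath, Prod.ext_iff]
  rw [e]
  exact (hexp.measurable_src i _).inter ((hexp.measurable_qnt i _).inter (hexp.measurable_out i _))

omit [IsProbabilityMeasure ℙ] in
include hexp in
lemma measurableSet_atom (n : ℕ) (s : ℕ → Sample X M Y) :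
    MeasurableSet {ω | ∀ i ≤ n, samplePath src qnt out ω i = s i} := by
  have e : {ω | ∀ i ≤ n, samplePath src qnt out ω i = s i} =
      ⋂ i, ⋂ _ : i ≤ n, {ω | samplePath src qnt out ω i = s i} := by
    ext ω; simp
  rw [e]
  exact MeasurableSet.iInter fun i => MeasurableSet.iInter fun _ =>
    measurableSet_samplePath_eq hexp i (s i)

omit [IsProbabilityMeasure ℙ] in
include hexp in
lemma measure_atom (n : ℕ) (s : ℕ → Sample X M Y) :
    ℙ.real {ω | ∀ i ≤ n, samplePath src qnt out ω i = s i} =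
      p0 (s 0).1 * (∏ i ∈ Finset.range n, T (s i).1 (s (i + 1)).1) *
        ∏ i ∈ Finset.range (n + 1),
          (1 / (Fintype.card (Quantizer X M) : ℝ) * O ((s i).2.1 (s i).1) (s i).2.2) := by
  rw [← hexp.law n (fun i => (s i).1) (fun i => (s i).2.1) (fun i => (s i).2.2)]
  congr 1
  ext ω
  simp [samplePath, Prod.ext_iff]

omit [IsProbabilityMeasure ℙ] in
include hexp in
lemma measure_atom_succ (n : ℕ) (s : ℕ → Sample X M Y) :
    ℙ.real {ω | ∀ i ≤ n + 1, samplePath src qnt out ω i = s i} =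
      ℙ.real {ω | ∀ i ≤ n, samplePath src qnt out ω i = s i} *
        transition T O (s n) (s (n + 1)) := by
  rw [measure_atom hexp, measure_atom hexp, Finset.prod_range_succ _ n,
    Finset.prod_range_succ _ (n + 1), transition]
  ring

omit [DecidableEq X] [Fintype M] [Fintype X] [Fintype Y] in
lemma extendPath_eq {n : ℕ} (s : ℕ → Sample X M Y) {i : ℕ} (hi : i ≤ n) :
    extendPath (fun j : Fin (n + 1) => s j) i = s i := by
  simp [extendPath, min_eq_left hi]

omit [MeasurableSpace Ω] in
/-- A function of the path up to time `n` is a finite combination of indicators. -/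
lemma apply_samplePath_eq_sum {n : ℕ} {F : (ℕ → Sample X M Y) → ℝ} (hF : DependsOn F (Set.Iic n))
    (ω : Ω) :
    F (samplePath src qnt out ω) = ∑ σ : Fin (n + 1) → Sample X M Y,
      {ω | ∀ i ≤ n, samplePath src qnt out ω i = extendPath σ i}.indicator
        (fun _ => F (extendPath σ)) ω := by
  rw [Finset.sum_eq_single fun j : Fin (n + 1) => samplePath src qnt out ω j]
  · rw [Set.indicator_of_mem (by intro i hi; exact (extendPath_eq _ hi).symm)]
    exact hF fun i hi => (extendPath_eq _ hi).symm
  · intro σ _ hσ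
    refine Set.indicator_of_notMem (fun h => hσ (funext fun j => ?_)) _
    have hj : (j : ℕ) ≤ n := Nat.lt_succ_iff.1 j.isLt
    rw [h j hj]
    simp [extendPath, min_eq_left hj]
  · intro h; exact absurd (Finset.mem_univ _) h

omit [IsProbabilityMeasure ℙ] in
include hexp in
lemma measurable_of_dependsOn {n : ℕ} {F : (ℕ → Sample X M Y) → ℝ} (hF : DependsOn F (Set.Iic n)) :
    Measurable fun ω => F (samplePath src qnt out ω) := by
  have e : (fun ω => F (samplePath src qnt out ω)) = fun ω =>
      ∑ σ : Fin (n + 1) → Sample X M Y,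
        {ω | ∀ i ≤ n, samplePath src qnt out ω i = extendPath σ i}.indicator
          (fun _ => F (extendPath σ)) ω := funext fun ω => apply_samplePath_eq_sum hF ω
  rw [e]
  exact Finset.measurable_sum _ fun σ _ =>
    measurable_const.indicator (measurableSet_atom hexp n _)

include hexp in
lemma integral_mul_indicator {n : ℕ} {F : (ℕ → Sample X M Y) → ℝ} (hF : DependsOn F (Set.Iic n))
    {B : Set Ω} (hB : MeasurableSet B) :
    ∫ ω, F (samplePath src qnt out ω) * B.indicator (fun _ => 1) ω ∂ℙ =
      ∑ σ : Fin (n + 1) → Sample X M Y, F (extendPath σ) *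
        ℙ.real ({ω | ∀ i ≤ n, samplePath src qnt out ω i = extendPath σ i} ∩ B) := by
  have hm := fun σ : Fin (n + 1) → Sample X M Y => measurableSet_atom hexp n (extendPath σ)
  have e : ∀ ω, F (samplePath src qnt out ω) * B.indicator (fun _ => 1) ω =
      ∑ σ : Fin (n + 1) → Sample X M Y,
        ({ω | ∀ i ≤ n, samplePath src qnt out ω i = extendPath σ i} ∩ B).indicator
          (fun _ => F (extendPath σ)) ω := by
    intro ω
    rw [apply_samplePath_eq_sum hF ω, Finset.sum_mul]
    refine Finset.sum_congr rfl fun σ _ => ?_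
    rw [← Set.inter_indicator_mul]
    simp
  simp_rw [e]
  rw [integral_finsetSum _ fun σ _ => (integrable_const _).indicator ((hm σ).inter hB)]
  refine Finset.sum_congr rfl fun σ _ => ?_
  rw [integral_indicator_const _ ((hm σ).inter hB), smul_eq_mul, mul_comm]

include hexp in
/-- The Markov property of the exploration process. -/
lemma integral_mul_apply_succ {n : ℕ} {F : (ℕ → Sample X M Y) → ℝ} (hF : DependsOn F (Set.Iic n))
    (f : Sample X M Y → ℝ) :
    ∫ ω, F (samplePath src qnt out ω) *
        (f (samplePath src qnt out ω (n + 1)) -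
          transitionExp T O f (samplePath src qnt out ω n)) ∂ℙ = 0 := by
  classical
  -- The Markov property for the indicator of one next sample, checked cylinder by cylinder:
  -- prescribing one more sample multiplies the probability by the transition probability.
  have hone : ∀ s', ∫ ω, F (samplePath src qnt out ω) *
        {ω | samplePath src qnt out ω (n + 1) = s'}.indicator (fun _ => 1) ω ∂ℙ =
      ∫ ω, F (samplePath src qnt out ω) *
        transition T O (samplePath src qnt out ω n) s' ∂ℙ := by
    intro s'
    have hF' : DependsOn (fun s : ℕ → Sample X M Y => F s * transition T O (s n) s')
        (Set.Iic n) := by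
      intro s t h
      have h1 := hF h
      have h2 := h n (Set.mem_Iic.2 le_rfl)
      simp only [h1, h2]
    have h1 := integral_mul_indicator hexp hF' MeasurableSet.univ
    simp only [Set.indicator_univ, mul_one, Set.inter_univ] at h1
    rw [h1, integral_mul_indicator hexp hF (measurableSet_samplePath_eq hexp (n + 1) s')]
    refine Finset.sum_congr rfl fun σ _ => ?_
    have e : {ω | ∀ i ≤ n, samplePath src qnt out ω i = extendPath σ i} ∩
        {ω | samplePath src qnt out ω (n + 1) = s'} =
        {ω | ∀ i ≤ n + 1, samplePath src qnt out ω i =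
          Function.update (extendPath σ) (n + 1) s' i} := by
      ext ω
      simp only [Set.mem_inter_iff, Set.mem_ofPred_eq]
      constructor
      · rintro ⟨h1, h2⟩ i hi
        rcases hi.eq_or_lt with rfl | hlt
        · rw [Function.update_self, h2]
        · rw [Function.update_of_ne hlt.ne, h1 i (by omega)]
      · intro h
        refine ⟨fun i hi => ?_, ?_⟩
        · have := h i (by omega)
          rwa [Function.update_of_ne (by omega)] at this
        · have := h (n + 1) le_rfl
          rwa [Function.update_self] at this
    have e2 : {ω | ∀ i ≤ n, samplePath src qnt out ω i =
          Function.update (extendPath σ) (n + 1) s' i} =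
        {ω | ∀ i ≤ n, samplePath src qnt out ω i = extendPath σ i} := by
      ext ω
      refine forall_congr' fun i => imp_congr_right fun hi => ?_
      rw [Function.update_of_ne (by omega)]
    rw [e, measure_atom_succ hexp, e2, Function.update_self, Function.update_of_ne (by omega)]
    ring
  have hmF := measurable_of_dependsOn hexp hF
  obtain ⟨C, hC⟩ : ∃ C, ∀ ω, |F (samplePath src qnt out ω)| ≤ C := by
    obtain ⟨C, hC⟩ := (Set.finite_range fun σ : Fin (n + 1) → Sample X M Y =>
      |F (extendPath σ)|).bddAbove
    refine ⟨C, fun ω => ?_⟩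
    have : F (samplePath src qnt out ω) =
        F (extendPath fun j : Fin (n + 1) => samplePath src qnt out ω j) :=
      hF fun i hi => (extendPath_eq _ hi).symm
    rw [this]
    exact hC ⟨_, rfl⟩
  have i1 : ∀ s', Integrable (fun ω => F (samplePath src qnt out ω) *
      {ω | samplePath src qnt out ω (n + 1) = s'}.indicator (fun _ => 1) ω) ℙ := by
    intro s'
    refine integrable_of_abs_le (C := C) (hmF.mul (measurable_const.indicator
      (measurableSet_samplePath_eq hexp (n + 1) s'))) fun ω => ?_
    rw [abs_mul]
    refine (mul_le_of_le_one_right (abs_nonneg _) ?_).trans (hC ω)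
    by_cases h : ω ∈ {ω | samplePath src qnt out ω (n + 1) = s'} <;> simp [h]
  have i2 : ∀ s', Integrable (fun ω => F (samplePath src qnt out ω) *
      transition T O (samplePath src qnt out ω n) s') ℙ := by
    intro s'
    obtain ⟨K, hK⟩ := (Set.finite_range fun s => |transition T O s s'|).bddAbove
    refine integrable_of_abs_le (C := C * K) (hmF.mul (measurable_of_dependsOn hexp (n := n)
      (F := fun s => transition T O (s n) s') fun s t h => by
        simp only [h n (Set.mem_Iic.2 le_rfl)])) fun ω => ?_
    rw [abs_mul]
    exact mul_le_mul (hC ω) (hK ⟨_, rfl⟩) (abs_nonneg _) ((abs_nonneg _).trans (hC ω))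
  have e : ∀ ω, F (samplePath src qnt out ω) *
        (f (samplePath src qnt out ω (n + 1)) -
          transitionExp T O f (samplePath src qnt out ω n)) =
      ∑ s', f s' * (F (samplePath src qnt out ω) *
        {ω | samplePath src qnt out ω (n + 1) = s'}.indicator (fun _ => 1) ω -
        F (samplePath src qnt out ω) * transition T O (samplePath src qnt out ω n) s') := by
    intro ω
    simp only [mul_sub, Finset.sum_sub_distrib, transitionExp, Finset.mul_sum]
    congr 1
    · rw [Finset.sum_eq_single (samplePath src qnt out ω (n + 1))]
      · simp [mul_comm]
      · intro s' _ hs'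
        rw [Set.indicator_of_notMem (by simpa using hs'.symm)]; ring
      · intro h; exact absurd (Finset.mem_univ _) h
    · exact Finset.sum_congr rfl fun s' _ => by ring
  have i3 : ∀ s', Integrable (fun ω => f s' * (F (samplePath src qnt out ω) *
      {ω | samplePath src qnt out ω (n + 1) = s'}.indicator (fun _ => 1) ω -
        F (samplePath src qnt out ω) * transition T O (samplePath src qnt out ω n) s')) ℙ :=
    fun s' => ((i1 s').sub (i2 s')).const_mul _
  simp_rw [e]
  rw [integral_finsetSum _ fun s' _ => i3 s']
  refine Finset.sum_eq_zero fun s' _ => ?_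
  rw [integral_const_mul, integral_sub (i1 s') (i2 s'), hone s', sub_self, mul_zero]

include hexp in
/-- The averages of the martingale differences of the exploration process vanish. -/
lemma ae_tendsto_average_martingale (r : ℕ) (A : ℕ → (ℕ → Sample X M Y) → ℝ)
    (hA : ∀ t, DependsOn (A t) (Set.Iic (t + r))) (hA1 : ∀ t s, |A t s| ≤ 1)
    (f : Sample X M Y → ℝ) :
    ∀ᵐ ω ∂ℙ, Tendsto (fun n : ℕ => (∑ t ∈ Finset.range n, A t (samplePath src qnt out ω) *
      (f (samplePath src qnt out ω (t + r + 1)) -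
        transitionExp T O f (samplePath src qnt out ω (t + r)))) / n) atTop (𝓝 0) := by
  obtain ⟨C, hC⟩ := (Set.finite_range fun p : Sample X M Y × Sample X M Y =>
    |f p.1 - transitionExp T O f p.2|).bddAbove
  have hdep : ∀ t, DependsOn (fun s : ℕ → Sample X M Y =>
      A t s * (f (s (t + r + 1)) - transitionExp T O f (s (t + r)))) (Set.Iic (t + r + 1)) := by
    intro t s s' h
    have h1 := hA t fun i hi => h i ((Set.mem_Iic.1 hi).trans (Nat.le_succ _))
    have h2 := h (t + r + 1) (Set.mem_Iic.2 le_rfl)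
    have h3 := h (t + r) (Set.mem_Iic.2 (Nat.le_succ _))
    simp only [h1, h2, h3]
  refine ae_tendsto_average_of_orthogonal (C := C)
    (fun t => measurable_of_dependsOn hexp (hdep t)) (fun t ω => ?_) fun s t hst => ?_
  · rw [abs_mul]
    exact (mul_le_of_le_one_left (abs_nonneg _) (hA1 t _)).trans
      (hC ⟨(samplePath src qnt out ω (t + r + 1), samplePath src qnt out ω (t + r)), rfl⟩)
  -- For `s < t` the earlier difference and the weight `A t` are functions of the path up to time `t
  -- + r`, so the Markov property makes the later difference orthogonal to the earlier one.
  · have := integral_mul_apply_succ hexp (n := t + r) (F := fun σ : ℕ → Sample X M Y =>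
      A s σ * (f (σ (s + r + 1)) - transitionExp T O f (σ (s + r))) * A t σ) (by
        intro σ σ' h
        have h1 := hdep s fun i hi => h i ((Set.mem_Iic.1 hi).trans (by omega))
        have h2 := hA t h
        simp only at h1
        simp only [h1, h2]) f
    rw [← this]
    congr 1
    funext ω
    ring

end Markov

/-! ### Empirical frequencies of windows and convergence of Q-learning -/

section Frequencies

variable {X M Y : Type*}

lemma dataWindow_succ {m : ℕ} (qs : ℕ → Quantizer X M) (ys : ℕ → Y) (t : ℕ) :
    (dataWindow qs ys t : Window X M Y (m + 1)) =
      snocWindow (dataWindow qs ys t) (ys (t + m)) (qs (t + m)) := by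
  refine Prod.ext (funext fun i => ?_) (funext fun i => ?_) <;>
  · induction i using Fin.lastCases <;> simp [dataWindow, snocWindow]

lemma dataWindow_shift {m : ℕ} (qs : ℕ → Quantizer X M) (ys : ℕ → Y) (t : ℕ) :
    (dataWindow qs ys (t + 1) : Window X M Y m) =
      shiftWindow (dataWindow qs ys t) (ys (t + m)) (qs (t + m)) := by
  have h := dataWindow_succ (m := m) qs ys t
  have h1 := congrArg (fun w => Fin.tail w.1) h
  have h2 := congrArg (fun w => Fin.tail w.2) h
  refine Prod.ext ?_ ?_
  · refine Eq.trans (funext fun i => ?_) h1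
    simp [dataWindow, Fin.tail, add_comm, add_left_comm]
  · refine Eq.trans (funext fun i => ?_) h2
    simp [dataWindow, Fin.tail, add_comm, add_left_comm]

lemma snocWindow_inj {m : ℕ} {I I' : Window X M Y m} {y y' : Y} {q q' : Quantizer X M} :
    snocWindow I y q = snocWindow I' y' q' ↔ I = I' ∧ y = y' ∧ q = q' := by
  have := (snocWindowEquiv (X := X) (M := M) (Y := Y) (N := m)).injective.eq_iff
    (a := (I, y, q)) (b := (I', y', q'))
  simpa [snocWindowEquiv] using this

/-- The averages over windows are first taken from time 1 on, so that even the first sample of a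
window follows another one and is drawn by the transition law. This lemma restores the starting time
0. -/
lemma tendsto_average_of_succ {a : ℕ → ℝ} {l : ℝ}
    (h : Tendsto (fun n : ℕ => (∑ t ∈ Finset.range n, a (t + 1)) / n) atTop (𝓝 l)) :
    Tendsto (fun n : ℕ => (∑ t ∈ Finset.range n, a t) / n) atTop (𝓝 l) := by
  rw [← tendsto_add_atTop_iff_nat 1]
  have h1 : Tendsto (fun n : ℕ => a 0 / ((n : ℝ) + 1)) atTop (𝓝 0) :=
    tendsto_const_nhds.div_atTop
      (tendsto_atTop_add_const_right _ _ tendsto_natCast_atTop_atTop)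
  have h2 := h1.add (h.mul (tendsto_natCast_div_add_atTop (1 : ℝ)))
  rw [zero_add, mul_one] at h2
  refine h2.congr fun n => ?_
  rw [Finset.sum_range_succ' a n]
  rcases Nat.eq_zero_or_pos n with rfl | hn
  · simp
  · push_cast
    field_simp
    ring

variable [Fintype X] [DecidableEq X] [Fintype M] [Fintype Y] {T : X → Belief X} {O : M → Belief Y}

lemma transitionExp_eq (f : Sample X M Y → ℝ) (s : Sample X M Y) :
    transitionExp T O f s = ∑ x, T s.1 x * ∑ q : Quantizer X M, ∑ y,
      1 / (Fintype.card (Quantizer X M) : ℝ) * O (q x) y * f (x, q, y) := by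
  simp only [transitionExp, transition, Fintype.sum_prod_type, Finset.mul_sum]
  exact Finset.sum_congr rfl fun x _ => Finset.sum_congr rfl fun q _ =>
    Finset.sum_congr rfl fun y _ => by ring

lemma sum_emission [Nonempty M] (x : X) :
    ∑ q : Quantizer X M, ∑ y, 1 / (Fintype.card (Quantizer X M) : ℝ) * O (q x) y = 1 := by
  simp_rw [← Finset.mul_sum, belief_sum]
  rw [Finset.sum_const, Finset.card_univ, nsmul_eq_mul, mul_one]
  have : (Fintype.card (Quantizer X M) : ℝ) ≠ 0 := by
    exact_mod_cast Fintype.card_ne_zero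
  field_simp

lemma transitionExp_source [Nonempty M] (h : X → ℝ) (s : Sample X M Y) :
    transitionExp T O (fun s' => h s'.1) s = ∑ x, T s.1 x * h x := by
  rw [transitionExp_eq]
  refine Finset.sum_congr rfl fun x _ => ?_
  simp_rw [← Finset.sum_mul]
  rw [sum_emission, one_mul]

/-- Given the source symbol, the pair of quantizer and output has an explicit law that does not
depend on the past, so its centred indicator has conditional mean zero, even after weighting by a
function of the symbol. -/
lemma transitionExp_emission [Nonempty M] [DecidableEq M] [DecidableEq Y] (h : X → ℝ)
    (q : Quantizer X M) (y : Y) (s : Sample X M Y) :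
    transitionExp T O (fun s' => h s'.1 * ((if s'.2 = (q, y) then 1 else 0) -
      1 / (Fintype.card (Quantizer X M) : ℝ) * O (q s'.1) y)) s = 0 := by
  rw [transitionExp_eq]
  refine Finset.sum_eq_zero fun x _ => mul_eq_zero_of_right _ ?_
  have e : ∀ (q' : Quantizer X M) (y' : Y),
      1 / (Fintype.card (Quantizer X M) : ℝ) * O (q' x) y' *
        (h x * ((if (q', y') = (q, y) then 1 else 0) -
          1 / (Fintype.card (Quantizer X M) : ℝ) * O (q x) y)) =
      h x * (if (q', y') = (q, y) then 1 / (Fintype.card (Quantizer X M) : ℝ) * O (q x) y else 0) -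
      (1 / (Fintype.card (Quantizer X M) : ℝ) * O (q' x) y') *
        (h x * (1 / (Fintype.card (Quantizer X M) : ℝ) * O (q x) y)) := by
    intro q' y'
    split_ifs with hqy
    · obtain ⟨rfl, rfl⟩ := Prod.mk.inj hqy
      ring
    · ring
  simp_rw [e, Finset.sum_sub_distrib]
  have e1 : ∑ q' : Quantizer X M, ∑ y' : Y, h x * (if (q', y') = (q, y) then
      1 / (Fintype.card (Quantizer X M) : ℝ) * O (q x) y else 0) =
      h x * (1 / (Fintype.card (Quantizer X M) : ℝ) * O (q x) y) := by
    rw [← Fintype.sum_prod_type' (f := fun q' y' => h x * (if (q', y') = (q, y) then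
      1 / (Fintype.card (Quantizer X M) : ℝ) * O (q x) y else 0))]
    simp
  rw [e1]
  simp_rw [← Finset.sum_mul]
  rw [sum_emission, one_mul, sub_self]

variable {Ω : Type*} [MeasurableSpace Ω] {ℙ : Measure Ω} [IsProbabilityMeasure ℙ] {p0 : Belief X}
  {src : ℕ → Ω → X} {qnt : ℕ → Ω → Quantizer X M} {out : ℕ → Ω → Y}
  (hexp : IsExploration ℙ T O p0 src qnt out)
  (hT : (Matrix.of fun x x' => T x x').IsIrreducible)
  {ζ : Belief X} (hζ : ∀ x', ∑ x, T x x' * ζ x = ζ x')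

include hexp hT hζ in
/-- The ergodic theorem for the source. -/
lemma ae_tendsto_average_source [Nonempty X] [Nonempty M] (h : X → ℝ) :
    ∀ᵐ ω ∂ℙ, Tendsto (fun n : ℕ => (∑ t ∈ Finset.range n, h (src (t + 1) ω)) / n) atTop
      (𝓝 (∑ x, ζ x * h x)) := by
  obtain ⟨g, hg⟩ := exists_poisson hT hζ h
  obtain ⟨C, hC⟩ := (Set.finite_range fun p : X × X => |g p.1 - g p.2|).bddAbove
  filter_upwards [ae_tendsto_average_martingale hexp 1 (fun _ _ => 1) (fun _ _ _ _ => rfl)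
    (fun _ _ => by simp) (fun s => g s.1)] with ω hω
  simp only [transitionExp_source, one_mul, samplePath] at hω
  have h1 : Tendsto (fun n : ℕ => (g (src 1 ω) - g (src (n + 1) ω)) / n) atTop (𝓝 0) := by
    refine squeeze_zero_norm (a := fun n : ℕ => C / n) (fun n => ?_)
      (tendsto_const_nhds.div_atTop tendsto_natCast_atTop_atTop)
    rw [Real.norm_eq_abs, abs_div, Nat.abs_cast]
    exact div_le_div_of_nonneg_right (hC ⟨(_, _), rfl⟩) (Nat.cast_nonneg n)
  have h2 := (hω.add h1).add_const (∑ x, ζ x * h x)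
  rw [zero_add, zero_add] at h2
  refine h2.congr' ?_
  filter_upwards [eventually_gt_atTop 0] with n hn
  have hn' : (n : ℝ) ≠ 0 := by exact_mod_cast hn.ne'
  have e1 : g (src 1 ω) - g (src (n + 1) ω) =
      ∑ t ∈ Finset.range n, (g (src (t + 1) ω) - g (src (t + 1 + 1) ω)) :=
    (Finset.sum_range_sub' (fun t => g (src (t + 1) ω)) n).symm
  -- By the Poisson equation, `h` minus its mean is a martingale difference plus an increment of
  -- `g`; the increments telescope to a bounded quantity.
  have e2 : ∑ t ∈ Finset.range n, h (src (t + 1) ω) =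
      ∑ t ∈ Finset.range n, (g (src (t + 1 + 1) ω) - ∑ x, T (src (t + 1) ω) x * g x) +
      ∑ t ∈ Finset.range n, (g (src (t + 1) ω) - g (src (t + 1 + 1) ω)) +
      n * ∑ x, ζ x * h x := by
    have e3 : (n : ℝ) * ∑ x, ζ x * h x = ∑ t ∈ Finset.range n, ∑ x, ζ x * h x := by simp
    rw [e3, ← Finset.sum_add_distrib, ← Finset.sum_add_distrib]
    refine Finset.sum_congr rfl fun t _ => ?_
    linarith [hg (src (t + 1) ω)]
  rw [e2, e1]
  field_simp

include hexp hT hζ in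
/-- The empirical frequencies of windows, jointly with the next source symbol. -/
lemma ae_tendsto_average_window [Nonempty X] [Nonempty M] [DecidableEq M] [DecidableEq Y] {m : ℕ}
    (I : Window X M Y m) (h : X → ℝ) :
    ∀ᵐ ω ∂ℙ, Tendsto (fun n : ℕ => (∑ t ∈ Finset.range n,
      if dataWindow (fun k => qnt k ω) (fun k => out k ω) (t + 1) = I
        then h (src (t + m + 1) ω) else 0) / n) atTop
      (𝓝 ((1 / (Fintype.card (Quantizer X M) : ℝ)) ^ m * ∑ x, windowMass T O ζ I x * h x)) := by
  induction m generalizing h with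
  | zero =>
    filter_upwards [ae_tendsto_average_source hexp hT hζ h] with ω hω
    have e : ∀ t, (dataWindow (fun k => qnt k ω) (fun k => out k ω) (t + 1) :
        Window X M Y 0) = I := fun t => Subsingleton.elim _ _
    simpa [e, windowMass] using hω
  | succ m ih =>
    obtain ⟨I', y, q, rfl⟩ := exists_snocWindow I
    set K : ℝ := (Fintype.card (Quantizer X M) : ℝ)
    set Th : X → ℝ := fun x => ∑ x', T x x' * h x' with hTh
    have hdep : ∀ (n : ℕ) (J : Window X M Y n) (r : ℕ), n ≤ r → ∀ t,
        DependsOn (fun s : ℕ → Sample X M Y =>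
        if dataWindow (fun k => (s k).2.1) (fun k => (s k).2.2) (t + 1) = J then (1 : ℝ) else 0)
        (Set.Iic (t + r)) := by
      intro n J r hr t s s' hs
      have : (dataWindow (fun k => (s k).2.1) (fun k => (s k).2.2) (t + 1) : Window X M Y n) =
          dataWindow (fun k => (s' k).2.1) (fun k => (s' k).2.2) (t + 1) := by
        refine Prod.ext (funext fun i => ?_) (funext fun i => ?_)
        · simp only [dataWindow]
          rw [hs _ (Set.mem_Iic.2 (by have := i.isLt; omega))]
        · simp only [dataWindow]
          rw [hs _ (Set.mem_Iic.2 (by have := i.isLt; omega))]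
      simp only [this]
    have hone : ∀ (n : ℕ) (J : Window X M Y n) (t : ℕ) (s : ℕ → Sample X M Y),
        |if dataWindow (fun k => (s k).2.1) (fun k => (s k).2.2) (t + 1) = J
          then (1 : ℝ) else 0| ≤ 1 := by
      intro n J t s
      split_ifs <;> simp
    -- The last pair of the window is removed in two replacements with vanishing average error. Here
    -- `h` of the next source symbol becomes its conditional mean `Th` at the preceding symbol.
    have hA := ae_tendsto_average_martingale hexp (m + 1)
      (fun t s => if dataWindow (fun k => (s k).2.1) (fun k => (s k).2.2) (t + 1) =
        snocWindow I' y q then (1 : ℝ) else 0)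
      (hdep (m + 1) _ (m + 1) le_rfl) (hone (m + 1) _) (fun s => h s.1)
    -- Here the indicator of the last pair becomes its conditional probability given the source
    -- symbol. What remains is the shorter window with the test function `1 / K * O (q x) y * Th x`.
    have hB := ae_tendsto_average_martingale hexp m
      (fun t s => if dataWindow (fun k => (s k).2.1) (fun k => (s k).2.2) (t + 1) = I'
        then (1 : ℝ) else 0)
      (hdep m _ m le_rfl) (hone m _)
      (fun s => Th s.1 * ((if s.2 = (q, y) then 1 else 0) - 1 / K * O (q s.1) y))
    filter_upwards [hA, hB, ih I' fun x => 1 / K * O (q x) y * Th x] with ω h1 h2 h3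
    simp only [transitionExp_source] at h1
    simp only [K, transitionExp_emission, sub_zero] at h2
    have h1' : Tendsto (fun n : ℕ => (∑ t ∈ Finset.range n,
        (if dataWindow (fun k => qnt k ω) (fun k => out k ω) (t + 1) = snocWindow I' y q
          then (1 : ℝ) else 0) * (h (src (t + (m + 1) + 1) ω) - Th (src (t + m + 1) ω))) / n) atTop
        (𝓝 0) := h1
    have h2' : Tendsto (fun n : ℕ => (∑ t ∈ Finset.range n,
        (if dataWindow (fun k => qnt k ω) (fun k => out k ω) (t + 1) = I' then (1 : ℝ) else 0) *
          (Th (src (t + m + 1) ω) * ((if (qnt (t + m + 1) ω, out (t + m + 1) ω) = (q, y)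
            then 1 else 0) - 1 / K * O (q (src (t + m + 1) ω)) y))) / n) atTop (𝓝 0) := h2
    have h4 := (h1'.add h2').add h3
    have hl : (0 : ℝ) + 0 + (1 / K) ^ m * ∑ x, windowMass T O ζ I' x * (1 / K * O (q x) y * Th x) =
        (1 / K) ^ (m + 1) * ∑ x, windowMass T O ζ (snocWindow I' y q) x * h x := by
      rw [windowMass_snoc, pow_succ, mul_assoc, zero_add, zero_add]
      congr 1
      simp only [massStep, hTh, Finset.mul_sum, Finset.sum_mul]
      rw [Finset.sum_comm]
      exact Finset.sum_congr rfl fun _ _ => Finset.sum_congr rfl fun _ _ => by ring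
    rw [hl] at h4
    refine h4.congr fun n => ?_
    rw [← add_div, ← add_div, ← Finset.sum_add_distrib, ← Finset.sum_add_distrib]
    congr 1
    refine Finset.sum_congr rfl fun t _ => ?_
    have hw : ((dataWindow (fun k => qnt k ω) (fun k => out k ω) (t + 1) : Window X M Y (m + 1)) =
        snocWindow I' y q) ↔
        (dataWindow (fun k => qnt k ω) (fun k => out k ω) (t + 1) = I' ∧
          (qnt (t + m + 1) ω, out (t + m + 1) ω) = (q, y)) := by
      rw [dataWindow_succ, snocWindow_inj, add_right_comm t 1 m]
      exact and_congr_right fun _ => and_comm.trans Prod.mk_inj.symm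
    by_cases ha : dataWindow (fun k => qnt k ω) (fun k => out k ω) (t + 1) = I'
    · by_cases hb : (qnt (t + m + 1) ω, out (t + m + 1) ω) = (q, y)
      · rw [if_pos (hw.2 ⟨ha, hb⟩), if_pos (hw.2 ⟨ha, hb⟩), if_pos ha, if_pos hb, if_pos ha]
        ring
      · rw [if_neg fun e => hb (hw.1 e).2, if_neg fun e => hb (hw.1 e).2, if_pos ha, if_neg hb,
          if_pos ha]
        ring
    · rw [if_neg fun e => ha (hw.1 e).1, if_neg fun e => ha (hw.1 e).1, if_neg ha, if_neg ha]
      ring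

include hexp hT hζ in
/-- The empirical averages of functions of the window, the action and the next output. -/
lemma ae_tendsto_average_next [Nonempty X] [Nonempty M] [DecidableEq M] [DecidableEq Y] {N : ℕ}
    (I : Window X M Y N) (q : Quantizer X M) (φ : Y → ℝ) :
    ∀ᵐ ω ∂ℙ, Tendsto (fun n : ℕ => (∑ t ∈ Finset.range n,
      if dataWindow (fun k => qnt k ω) (fun k => out k ω) t = I ∧ qnt (t + N) ω = q
        then φ (out (t + N) ω) else 0) / n) atTop
      (𝓝 ((1 / (Fintype.card (Quantizer X M) : ℝ)) ^ (N + 1) * (∑ x, windowMass T O ζ I x) *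
        ∑ y, outputProb O (predictor T O (ζ, I)) q y * φ y)) := by
  have h := ae_all_iff.2 fun y => ae_tendsto_average_window hexp hT hζ (snocWindow I y q)
    fun _ => 1
  filter_upwards [h] with ω hω
  -- A window, an action and the following output together form a window of length `N + 1`; summing
  -- over the output with weight `φ` gives the average.
  have h1 := tendsto_finsetSum Finset.univ fun y _ =>
    (tendsto_average_of_succ (a := fun t =>
      if dataWindow (fun k => qnt k ω) (fun k => out k ω) t = snocWindow I y q
        then (1 : ℝ) else 0) (hω y)).mul_const (φ y)
  have e : ∑ y, (1 / (Fintype.card (Quantizer X M) : ℝ)) ^ (N + 1) *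
        (∑ x, windowMass T O ζ (snocWindow I y q) x * 1) * φ y =
      (1 / (Fintype.card (Quantizer X M) : ℝ)) ^ (N + 1) * (∑ x, windowMass T O ζ I x) *
        ∑ y, outputProb O (predictor T O (ζ, I)) q y * φ y := by
    rw [Finset.mul_sum]
    refine Finset.sum_congr rfl fun y _ => ?_
    simp only [mul_one]
    rw [sum_windowMass_snoc]
    ring
  rw [e] at h1
  refine h1.congr fun n => ?_
  simp_rw [div_mul_eq_mul_div, Finset.sum_mul]
  rw [← Finset.sum_div, Finset.sum_comm]
  congr 1
  refine Finset.sum_congr rfl fun t _ => ?_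
  simp_rw [dataWindow_succ, snocWindow_inj]
  by_cases hc : dataWindow (fun k => qnt k ω) (fun k => out k ω) t = I ∧ qnt (t + N) ω = q
  · rw [if_pos hc, Finset.sum_eq_single (out (t + N) ω)]
    · rw [if_pos ⟨hc.1, rfl, hc.2⟩, one_mul]
    · intro y _ hy
      rw [if_neg fun e => hy e.2.1.symm, zero_mul]
    · intro h; exact absurd (Finset.mem_univ _) h
  · rw [if_neg hc]
    exact Finset.sum_eq_zero fun y _ => by rw [if_neg fun e => hc ⟨e.1, e.2.2⟩, zero_mul]

omit [DecidableEq X] in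
-- For each length there are finitely many cylinders, and the null ones are avoided almost surely.
-- Hence the path uses only transitions and outputs of positive probability.
lemma ae_atom_pos :
    ∀ᵐ ω ∂ℙ, ∀ n : ℕ, ℙ.real {ω' | ∀ i ≤ n, samplePath src qnt out ω' i =
      samplePath src qnt out ω i} ≠ 0 := by
  refine ae_all_iff.2 fun n => ?_
  have h : ∀ᵐ ω ∂ℙ, ∀ σ : Fin (n + 1) → Sample X M Y,
      ℙ.real {ω' | ∀ i ≤ n, samplePath src qnt out ω' i = extendPath σ i} = 0 →
        ω ∉ {ω' | ∀ i ≤ n, samplePath src qnt out ω' i = extendPath σ i} := by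
    refine ae_all_iff.2 fun σ => ?_
    by_cases h0 : ℙ.real {ω' | ∀ i ≤ n, samplePath src qnt out ω' i = extendPath σ i} = 0
    · filter_upwards [measure_eq_zero_iff_ae_notMem.1
        ((measureReal_eq_zero_iff (measure_ne_top _ _)).1 h0)] with ω hω _ using hω
    · exact Eventually.of_forall fun ω h => absurd h h0
  filter_upwards [h] with ω hω h0
  refine hω (fun j => samplePath src qnt out ω j) ?_ fun i hi => (extendPath_eq _ hi).symm
  rw [← h0]
  congr 1
  ext ω'
  refine forall_congr' fun i => imp_congr_right fun hi => ?_
  rw [extendPath_eq _ hi]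

include hexp hT hζ in
/-- Almost surely, only windows of positive stationary probability are seen. -/
lemma ae_sum_windowMass_pos (N : ℕ) :
    ∀ᵐ ω ∂ℙ, ∀ t, 0 < ∑ x, windowMass T O ζ
      (dataWindow (fun k => qnt k ω) (fun k => out k ω) t : Window X M Y N) x := by
  filter_upwards [ae_atom_pos (ℙ := ℙ) (src := src) (qnt := qnt) (out := out)] with ω hω t
  have hTO : ∀ i, 0 < T (src i ω) (src (i + 1) ω) ∧ 0 < O (qnt i ω (src i ω)) (out i ω) := by
    intro i
    have h := hω (i + 1)
    rw [measure_atom hexp] at h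
    have h1 := Finset.prod_ne_zero_iff.1 (right_ne_zero_of_mul (left_ne_zero_of_mul h)) i
      (Finset.mem_range.2 (Nat.lt_succ_self i))
    have h2 := right_ne_zero_of_mul (Finset.prod_ne_zero_iff.1 (right_ne_zero_of_mul h) i
      (Finset.mem_range.2 (by omega)))
    exact ⟨(belief_nonneg _ _).lt_of_ne' h1, (belief_nonneg _ _).lt_of_ne' h2⟩
  have hpos : ∀ m : ℕ, 0 < windowMass T O ζ
      (dataWindow (fun k => qnt k ω) (fun k => out k ω) t : Window X M Y m) (src (t + m) ω) := by
    intro m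
    induction m with
    | zero => simpa [windowMass] using invariant_pos hT hζ (src t ω)
    | succ m ih =>
      rw [dataWindow_succ, windowMass_snoc, massStep]
      obtain ⟨h1, h2⟩ := hTO (t + m)
      exact (mul_pos h1 (mul_pos h2 ih)).trans_le (Finset.single_le_sum
        (f := fun x => T x (src (t + (m + 1)) ω) * (O (qnt (t + m) ω x) (out (t + m) ω) *
          windowMass T O ζ (dataWindow (fun k => qnt k ω) (fun k => out k ω) t) x))
        (fun x _ => mul_nonneg (belief_nonneg _ _) (mul_nonneg (belief_nonneg _ _)
          (windowMass_nonneg T O (belief_nonneg ζ) _ x))) (Finset.mem_univ _))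
  exact (hpos N).trans_le (Finset.single_le_sum
    (fun x _ => windowMass_nonneg T O (belief_nonneg ζ) _ x) (Finset.mem_univ _))

include hexp hT hζ in
/-- Q-learning on windows converges almost surely to the value of the finite model at the windows
of positive stationary probability, and is constant at the other ones. -/
lemma ae_tendsto_windowQ [Nonempty X] [Nonempty M] [DecidableEq M] [DecidableEq Y]
    {Xh : Type*} [Fintype Xh] [Nonempty Xh] {d : X → Xh → ℝ} {β : ℝ} (hβ0 : 0 < β) (hβ1 : β < 1)
    {N : ℕ} (V0 : Window X M Y N → Quantizer X M → ℝ) {V : Window X M Y N → Quantizer X M → ℝ}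
    (hV : IsWindowValue T O ζ d β V) :
    ∀ᵐ ω ∂ℙ, ∀ I q,
      Tendsto (fun t => windowQ N T O d β ζ V0 (fun k => qnt k ω) (fun k => out k ω) t I q) atTop
        (𝓝 (if 0 < ∑ x, windowMass T O ζ I x then V I q else V0 I q)) := by
  have h1 := ae_all_iff.2 fun I : Window X M Y N => ae_all_iff.2 fun q =>
    ae_tendsto_average_next hexp hT hζ I q fun _ => 1
  have h2 := ae_all_iff.2 fun I : Window X M Y N => ae_all_iff.2 fun q =>
    ae_tendsto_average_next hexp hT hζ I q fun y =>
      Finset.univ.inf' Finset.univ_nonempty (V (shiftWindow I y q))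
  filter_upwards [h1, h2, ae_sum_windowMass_pos hexp hT hζ N] with ω h1 h2 h3 I q
  set z : ℕ → Window X M Y N := fun t => dataWindow (fun k => qnt k ω) (fun k => out k ω) t with hz
  set u : ℕ → Quantizer X M := fun t => qnt (t + N) ω with hu
  by_cases hI : 0 < ∑ x, windowMass T O ζ I x
  · rw [if_pos hI]
    have hK : (0 : ℝ) < 1 / (Fintype.card (Quantizer X M) : ℝ) := by
      have : (0 : ℝ) < (Fintype.card (Quantizer X M) : ℝ) := by exact_mod_cast Fintype.card_pos
      positivity
    have hfreq : ∀ I q, Tendsto (fun n : ℕ => visits z u I q n / n) atTop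
        (𝓝 ((1 / (Fintype.card (Quantizer X M) : ℝ)) ^ (N + 1) *
          ∑ x, windowMass T O ζ I x)) := by
      intro I q
      have := h1 I q
      simp only [mul_one, outputProb_sum] at this
      exact this
    refine tendsto_qIterate (z := z) (u := u)
      (G := fun I => 0 < ∑ x, windowMass T O ζ I x)
      (cost := fun I q => stageCost O d (predictor T O (ζ, I)) q)
      (m := fun I q => ∑ y, outputProb O (predictor T O (ζ, I)) q y *
        Finset.univ.inf' Finset.univ_nonempty (V (shiftWindow I y q)))
      hβ0 hβ1 h3 (fun _ => rfl) (fun I _ q => hV I q) (fun I hI q => ?_) (fun I hI q => ?_) hI q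
    -- A window of positive mass has a positive limiting frequency with each action, so its visits
    -- tend to infinity; the conditional averages are then quotients of two frequencies.
    · have h4 := (hfreq I q).pos_mul_atTop (mul_pos (pow_pos hK _) hI)
        tendsto_natCast_atTop_atTop
      refine h4.congr' ?_
      filter_upwards [eventually_gt_atTop 0] with n hn
      have : (n : ℝ) ≠ 0 := by exact_mod_cast hn.ne'
      field_simp
    · have hc := mul_pos (pow_pos hK (N + 1)) hI
      have h4 := (h2 I q).div (hfreq I q) hc.ne'
      rw [mul_div_cancel_left₀ _ hc.ne'] at h4
      refine h4.congr' ?_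
      filter_upwards [eventually_gt_atTop 0] with n hn
      have : (n : ℝ) ≠ 0 := by exact_mod_cast hn.ne'
      rw [Pi.div_apply, div_div_div_cancel_right₀ this]
      congr 1
      refine Finset.sum_congr rfl fun k _ => ?_
      by_cases hk : z k = I ∧ u k = q
      · rw [if_pos hk]
        refine Eq.trans ?_ (if_pos hk).symm
        have : z (k + 1) = shiftWindow I (out (k + N) ω) q := by
          rw [← hk.1, ← hk.2]
          exact dataWindow_shift _ _ k
        rw [this]
      · rw [if_neg hk]
        exact (if_neg hk).symm
  · rw [if_neg hI]
    -- The data windows all have positive mass, so this window never occurs and its entries are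
    -- never updated.
    have hne : ∀ t, z t ≠ I := fun t e => hI (e ▸ h3 t)
    have : ∀ t, windowQ N T O d β ζ V0 (fun k => qnt k ω) (fun k => out k ω) t I q = V0 I q :=
      fun t => qIterate_eq_of_forall_ne β V0 z u _ hne t q
    simp_rw [this]
    exact tendsto_const_nhds

end Frequencies

end

end ZeroDelay

/-! ### Assembly -/

theorem mainTheorem2
    {X M Y Xh : Type*}
    [Fintype X] [Nonempty X] [DecidableEq X]
    [Fintype M] [Nonempty M] [DecidableEq M]
    [Fintype Y] [DecidableEq Y]
    [Fintype Xh] [Nonempty Xh]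
    (T : X → ZeroDelay.Belief X)
    (hT_irr : (Matrix.of fun x x' => T x x').IsIrreducible)
    (hT_aper : ZeroDelay.IsAperiodic T)
    (O : M → ZeroDelay.Belief Y)
    (d : X → Xh → ℝ) (hd : ∀ x xh, 0 ≤ d x xh)
    (β : ℝ) (hβ0 : 0 < β) (hβ1 : β < 1)
    (N : ℕ)
    (ζ : ZeroDelay.Belief X) (hζ : ∀ x', ∑ x, T x x' * ζ x = ζ x')
    {Ω : Type*} [MeasurableSpace Ω] (ℙ : Measure Ω) [IsProbabilityMeasure ℙ]
    (p0 : ZeroDelay.Belief X)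
    (src : ℕ → Ω → X) (qnt : ℕ → Ω → ZeroDelay.Quantizer X M) (out : ℕ → Ω → Y)
    (hexp : ZeroDelay.IsExploration ℙ T O p0 src qnt out)
    (V0 : ZeroDelay.Window X M Y N → ZeroDelay.Quantizer X M → ℝ) :
    ∃ Vstar : ZeroDelay.Window X M Y N → ZeroDelay.Quantizer X M → ℝ,
      (∀ᵐ ω ∂ℙ, ∀ I q,
        Tendsto
          (fun t => ZeroDelay.windowQ N T O d β ζ V0 (fun k => qnt k ω) (fun k => out k ω) t I q)
          atTop (𝓝 (Vstar I q))) ∧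
      ∀ greedy : ZeroDelay.Window X M Y N → ZeroDelay.Quantizer X M,
        (∀ I q, Vstar I (greedy I) ≤ Vstar I q) →
        (1 - ZeroDelay.dobrushin T) * (2 - ZeroDelay.dobrushin O) < 1 →
        ∀ (μ : ZeroDelay.Belief X) (g : ZeroDelay.InitialPolicy X M Y N),
          ZeroDelay.initialExp T O μ g (fun w =>
              ZeroDelay.discountedCost T O d β w (fun v => greedy v.2)
                - ZeroDelay.optimalCost T O d β w)
            ≤ 4 * ZeroDelay.distNorm d / (1 - β) ^ 2
                * ((1 - ZeroDelay.dobrushin T) * (2 - ZeroDelay.dobrushin O)) ^ N := by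
  obtain ⟨V, hV, hVb⟩ := ZeroDelay.exists_isWindowValue (N := N) T O hd hβ0 hβ1 ζ
  -- The limit is deterministic because the set of windows that are ever updated is, almost surely,
  -- contained in the set of positive stationary mass, on which the limit is `V`.
  refine ⟨fun I q => if 0 < ∑ x, ZeroDelay.windowMass T O ζ I x then V I q else V0 I q,
    ZeroDelay.ae_tendsto_windowQ hexp hT_irr hζ hβ0 hβ1 V0 hV, fun greedy hgreedy _ μ g => ?_⟩
  refine ZeroDelay.initialExp_greedy_sub_optimal_le T O hd hβ0 hβ1 ζ hV hVb hζ
    (ZeroDelay.invariant_pos hT_irr hζ) greedy (fun I hI q => ?_) μ g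
  -- At a window of positive mass the limit coincides with `V` for all actions, so minimizing one is
  -- minimizing the other.
  have h := hgreedy I q
  simpa only [if_pos hI] using h
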